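/- Let $(\Omega,\mathcal M,\mathbb P)$ be a probability space and $d\in\mathbb N$. Let $T_i:\Omega\to\Omega$, $i\in\mathbb Z^d$, be measure preserving transformations which are ergodic: every measurable $A$ with $T_i^{-1}A=A$ for all $i$ has $\mathbb P(A)\in\{0,1\}$. Let $\mathcal H=\ell^2(\mathbb Z^d)$ (discrete model) or $\mathcal H=L^2(\mathbb R^d)$ (continuous model), let $(U_i\varphi)(x)=\varphi(x-i)$, $i\in\mathbb Z^d$, be the translations in $\mathcal H$, and let $\{H_\omega\}_{\omega\in\Omega}$ be an ergodic family of (possibly unbounded) selfadjoint operators in $\mathcal H$, that is: $\omega\mapsto\langle x,(H_\omega-z)^{-1}y\rangle$ is measurable for all $z\in\mathbb C\setminus\mathbb R$ and $x,y\in\mathcal H$, and $H_{T_i\omega}=U_iH_\omega U_i^*$ for all $i$ and $\omega$. Let $E_{H_\omega}$ be the spectral projection measure of $H_\omega$, and define the density of states measure on Borel sets $A\subset\mathbb R$ by $$\nu(A)=\mathbb E\,\langle\delta_0,E_{H_\omega}(A)\delta_0\rangle\ \text{ (discrete model)},\qquad \nu(A)=\mathbb E\,\operatorname{tr}\bigl(\chi_\Lambda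 E_{H_\omega}(A)\chi_\Lambda\bigr)\ \text{ (continuous model)},$$ where $\Lambda=[-\tfrac12,\tfrac12]^d$. A set $\sigma_\star\subset\mathbb R$ is called an almost sure spectrum of the family if there are closed subspaces $M_\omega\subset\mathcal H$ reducing $H_\omega$ such that $\sigma_\star=\sigma(H_\omega|_{M_\omega})$ for $\mathbb P$-almost every $\omega$ (for example, $M_\omega$ may be $\mathcal H$, or the absolutely continuous, singular continuous or pure point subspace of $H_\omega$, when the corresponding spectrum is almost surely constant). Then, in both models: (1) If $\gamma$ is a Borel measure on $\mathbb R$ such that $\nu$ is absolutely continuous with respect to $\gamma$, then for every almost sure spectrum $\sigma_\star$ and every closed, possibly unbounded, interval $I\subset\mathbb R$, $\gamma(I\cap\sigma_\star)=0$ implies $I^\circ\cap\sigma_\star=\emptyset$, where $I^\circ$ is the interior of $I$. (2) In particular, if the integrated density of states is absolutely continuous, that is, if $\nu$ is absolutely continuous with respect to Lebesgue measure, then every almost sure spectrum is either empty or of positive Lebesgue measure. -/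

import Mathlib

open MeasureTheory Complex
open scoped ENNReal

noncomputable section

namespace RandomSpectra

/-! ### Unbounded operators: resolvent, spectrum, reducing subspaces -/

section Operators

variable {E : Type*} [NormedAddCommGroup E] [InnerProductSpace ℂ E]

/-- The bounded operator `R` is a two-sided inverse of `H - z : D(H) → E`. -/
def IsResolventAt (H : E →ₗ.[ℂ] E) (z : ℂ) (R : E →L[ℂ] E) : Prop :=
  (∀ y : E, ∃ h : R y ∈ H.domain, H ⟨R y, h⟩ - z • R y = y) ∧
    ∀ x : H.domain, R (H x - z • (x : E)) = x

/-- The spectrum of an unbounded operator: those `z` for which `H - z : D(H) → E` has no bounded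
two-sided inverse. -/
def opSpectrum (H : E →ₗ.[ℂ] E) : Set ℂ := {z | ¬ ∃ R, IsResolventAt H z R}

open scoped Classical in
/-- The resolvent `(H - z)⁻¹`, with value `0` if `z` lies in the spectrum. -/
def resolventOp (H : E →ₗ.[ℂ] E) (z : ℂ) : E →L[ℂ] E :=
  if h : ∃ R, IsResolventAt H z R then h.choose else 0

/-- `M` reduces `H`: `u ∈ D(H)` implies `P u ∈ D(H)` and `H P u ∈ M`, where `P` is the orthogonal
projection onto the closed subspace `M`. -/
def Reduces [CompleteSpace E] (M : ClosedSubmodule ℂ E) (H : E →ₗ.[ℂ] E) : Prop :=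
  ∀ u ∈ H.domain, ∃ h : M.toSubmodule.starProjection u ∈ H.domain,
    H ⟨M.toSubmodule.starProjection u, h⟩ ∈ M.toSubmodule

/-- A reducing subspace is invariant. -/
theorem Reduces.map_mem [CompleteSpace E] {M : ClosedSubmodule ℂ E} {H : E →ₗ.[ℂ] E}
    (hM : Reduces M H) (x : H.domain) (hx : (x : E) ∈ M.toSubmodule) : H x ∈ M.toSubmodule := by
  obtain ⟨h, h'⟩ := hM x x.2
  have e : (⟨M.toSubmodule.starProjection (x : E), h⟩ : H.domain) = x :=
    Subtype.ext (Submodule.starProjection_eq_self_iff.mpr hx)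
  rwa [e] at h'

/-- The restriction `H|_M`, with domain `M ∩ D(H)`, as an operator in the Hilbert space `M`. -/
def restrictTo [CompleteSpace E] (H : E →ₗ.[ℂ] E) (M : ClosedSubmodule ℂ E) (hM : Reduces M H) :
    M.toSubmodule →ₗ.[ℂ] M.toSubmodule where
  domain := H.domain.comap M.toSubmodule.subtype
  toFun :=
    { toFun := fun x => ⟨H ⟨((x : M.toSubmodule) : E), x.2⟩, hM.map_mem _ x.1.2⟩
      map_add' := fun x y => Subtype.ext (H.map_add ⟨((x : M.toSubmodule) : E), x.2⟩
        ⟨((y : M.toSubmodule) : E), y.2⟩)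
      map_smul' := fun c x => Subtype.ext (H.map_smul c ⟨((x : M.toSubmodule) : E), x.2⟩) }

/-- The operator `U H U⋆` with domain `U D(H)`, for a unitary `U`. -/
def unitaryConj (U : E ≃ₗᵢ[ℂ] E) (H : E →ₗ.[ℂ] E) : E →ₗ.[ℂ] E where
  domain := H.domain.comap (U.symm.toLinearEquiv : E →ₗ[ℂ] E)
  toFun :=
    { toFun := fun x => U (H ⟨U.symm (x : E), x.2⟩)
      map_add' := fun x y => by
        rw [← map_add, ← H.map_add]
        congr 2
        exact Subtype.ext (map_add U.symm (x : E) (y : E))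
      map_smul' := fun c x => by
        rw [RingHom.id_apply, ← map_smul, ← H.map_smul]
        congr 2
        exact Subtype.ext (map_smul U.symm c (x : E)) }

end Operators

/-! ### Spectral projections -/

section SpectralMeasure

variable {E : Type*} [NormedAddCommGroup E] [InnerProductSpace ℂ E] [CompleteSpace E]

/-- A projection-valued measure on the Borel sets of `ℝ`. -/
structure IsProjectionValuedMeasure (F : Set ℝ → E →L[ℂ] E) : Prop where
  isStarProjection : ∀ A, MeasurableSet A → IsStarProjection (F A)
  univ : F Set.univ = 1
  inter : ∀ A B, MeasurableSet A → MeasurableSet B → F (A ∩ B) = F A * F B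
  hasSum : ∀ A : ℕ → Set ℝ, (∀ n, MeasurableSet (A n)) → Pairwise (Function.onFun Disjoint A) →
    ∀ x, HasSum (fun n => F (A n) x) (F (⋃ n, A n) x)

theorem IsProjectionValuedMeasure.inner_nonneg {F : Set ℝ → E →L[ℂ] E}
    (hF : IsProjectionValuedMeasure F) (x : E) {A : Set ℝ} (hA : MeasurableSet A) :
    0 ≤ (inner ℂ x (F A x)).re := by
  have h := (hF.isStarProjection A hA).nonneg
  rw [ContinuousLinearMap.nonneg_iff_isPositive] at h
  exact h.re_inner_nonneg_right x

theorem IsProjectionValuedMeasure.empty {F : Set ℝ → E →L[ℂ] E}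
    (hF : IsProjectionValuedMeasure F) (x : E) : F ∅ x = 0 := by
  have h := hF.hasSum (fun _ => ∅) (fun _ => MeasurableSet.empty)
    (fun _ _ _ => by simp [Function.onFun]) x
  exact (summable_const_iff _).mp h.summable

/-- The measure `A ↦ ⟨x, F(A) x⟩`. -/
def IsProjectionValuedMeasure.scalarMeasure {F : Set ℝ → E →L[ℂ] E}
    (hF : IsProjectionValuedMeasure F) (x : E) : Measure ℝ :=
  Measure.ofMeasurable (fun A _ => ENNReal.ofReal (inner ℂ x (F A x)).re)
    (by simp [hF.empty x])
    (by
      intro A hA hd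
      have h : HasSum (fun n => (inner ℂ x (F (A n) x)).re) (inner ℂ x (F (⋃ n, A n) x)).re :=
        Complex.hasSum_re ((hF.hasSum A hA hd x).mapL (innerSL ℂ x))
      rw [← h.tsum_eq]
      exact ENNReal.ofReal_tsum_of_nonneg (fun n => hF.inner_nonneg x (hA n)) h.summable)

/-- `H = ∫ t dF(t)`: the domain of `H` is `{x | ∫ t² d⟨x, F(t) x⟩ < ∞}`, and on it
`⟨x, H x⟩ = ∫ t d⟨x, F(t) x⟩` (which determines `H x`, by polarization). -/
def IsSpectralMeasureOf (H : E →ₗ.[ℂ] E) (F : Set ℝ → E →L[ℂ] E) : Prop :=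
  ∃ hF : IsProjectionValuedMeasure F,
    (∀ x : E, x ∈ H.domain ↔ ∫⁻ t, ENNReal.ofReal (t ^ 2) ∂(hF.scalarMeasure x) < ∞) ∧
    ∀ x : H.domain, inner ℂ (x : E) (H x) = ((∫ t, t ∂(hF.scalarMeasure (x : E)) : ℝ) : ℂ)

open scoped Classical in
/-- The spectral projection `E_H(A) = χ_A(H)` of a self-adjoint operator `H`, for `A` Borel. By the
spectral theorem the `if` always takes the first branch when `H` is self-adjoint, and the values
on Borel sets do not depend on the choice. -/
def spectralProjection (H : E →ₗ.[ℂ] E) (A : Set ℝ) : E →L[ℂ] E :=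
  if h : ∃ F, IsSpectralMeasureOf H F then h.choose A else 0

/-- The trace `∑ₙ ⟨φₙ, B φₙ⟩ ∈ [0, ∞]` of a positive bounded operator, in a chosen orthonormal
basis (the value does not depend on the basis). -/
def posTrace (B : E →L[ℂ] E) : ℝ≥0∞ :=
  ∑' φ : (exists_hilbertBasis ℂ E).choose, ENNReal.ofReal (inner ℂ (φ : E) (B φ)).re

end SpectralMeasure

/-! ### Ergodic families of self-adjoint operators, almost sure spectra -/

section Families

variable {Ω : Type*} [MeasurableSpace Ω] {ι : Type*}

/-- A measure preserving and ergodic family of transformations. -/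
structure IsErgodicFamily (P : Measure Ω) (T : ι → Ω → Ω) : Prop where
  measurePreserving : ∀ i, MeasurePreserving (T i) P P
  ergodic : ∀ A, MeasurableSet A → (∀ i, T i ⁻¹' A = A) → P A = 0 ∨ P A = 1

variable {E : Type*} [NormedAddCommGroup E] [InnerProductSpace ℂ E] [CompleteSpace E]

/-- A measurable family of self-adjoint operators: all resolvents `(H_ω - z)⁻¹`, `z ∉ ℝ`, are
weakly measurable. -/
structure IsMeasurableSelfAdjointFamily (H : Ω → E →ₗ.[ℂ] E) : Prop where
  isSelfAdjoint : ∀ ω, IsSelfAdjoint (H ω)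
  measurable : ∀ z : ℂ, z.im ≠ 0 → ∀ x y : E,
    Measurable fun ω => inner ℂ x (resolventOp (H ω) z y)

/-- An ergodic family of self-adjoint operators: `H_{T_i ω} = U_i H_ω U_i⋆` for the ergodic family
`T` and the given unitaries `U`. -/
structure IsErgodicOperatorFamily (P : Measure Ω) (T : ι → Ω → Ω) (U : ι → E ≃ₗᵢ[ℂ] E)
    (H : Ω → E →ₗ.[ℂ] E) : Prop extends IsMeasurableSelfAdjointFamily H where
  ergodicFamily : IsErgodicFamily P T
  covariant : ∀ i ω, H (T i ω) = unitaryConj (U i) (H ω)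

/-- `S ⊆ ℝ` is an almost sure spectrum of the family `H`: there are closed subspaces `M_ω`
reducing `H_ω` such that `S = σ(H_ω|_{M_ω})` for almost all `ω`. -/
def IsAlmostSureSpectrum (P : Measure Ω) (H : Ω → E →ₗ.[ℂ] E) (S : Set ℝ) : Prop :=
  ∃ (M : Ω → ClosedSubmodule ℂ E) (hM : ∀ ω, Reduces (M ω) (H ω)),
    ∀ᵐ ω ∂P, opSpectrum (restrictTo (H ω) (M ω) (hM ω)) = Complex.ofReal '' S

end Families

/-! ### The discrete model: operators in `ℓ²(ℤᵈ)` -/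

section Discrete

/-- The Hilbert space `ℓ²(ℤᵈ)`. -/
abbrev LatticeL2 (d : ℕ) : Type := lp (fun _ : Fin d → ℤ => ℂ) 2

/-- The translation `(U_i φ)(n) = φ(n - i)` as a linear map of `ℓ²(ℤᵈ)`. -/
def latticeShiftₗ {d : ℕ} (i : Fin d → ℤ) : LatticeL2 d →ₗ[ℂ] LatticeL2 d where
  toFun φ := ⟨fun n => φ (n - i), memℓp_gen
    (((memℓp_gen_iff (by norm_num)).1 φ.2).comp_injective (sub_left_injective (b := i)))⟩
  map_add' _ _ := rfl
  map_smul' _ _ := rfl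

/-- The translation `(U_i φ)(n) = φ(n - i)` as a unitary operator in `ℓ²(ℤᵈ)`. -/
def latticeShift {d : ℕ} (i : Fin d → ℤ) : LatticeL2 d ≃ₗᵢ[ℂ] LatticeL2 d where
  toLinearEquiv := LinearEquiv.ofLinearMap (latticeShiftₗ i) (latticeShiftₗ (-i))
    (by
      refine LinearMap.ext fun φ => lp.ext (funext fun n => ?_)
      change φ (n - i - -i) = φ n
      simp)
    (by
      refine LinearMap.ext fun φ => lp.ext (funext fun n => ?_)
      change φ (n - -i - i) = φ n
      simp)
  norm_map' φ := by
    rw [lp.norm_eq_tsum_rpow (by norm_num), lp.norm_eq_tsum_rpow (by norm_num)]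
    congr 1
    exact (Equiv.subRight i).tsum_eq (fun n => ‖φ n‖ ^ (2 : ℝ≥0∞).toReal)

theorem latticeShift_apply {d : ℕ} (i : Fin d → ℤ) (φ : LatticeL2 d) (n : Fin d → ℤ) :
    latticeShift i φ n = φ (n - i) := rfl

/-- The function `δ₀ ∈ ℓ²(ℤᵈ)`. -/
def delta₀ (d : ℕ) : LatticeL2 d := lp.single 2 0 1

/-- The density of states measure `ν(A) = 𝔼 ⟨δ₀, E_{H_ω}(A) δ₀⟩` of a Borel set `A`. -/
def discreteDOS {d : ℕ} {Ω : Type*} [MeasurableSpace Ω] (P : Measure Ω)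
    (H : Ω → LatticeL2 d →ₗ.[ℂ] LatticeL2 d) (A : Set ℝ) : ℝ≥0∞ :=
  ∫⁻ ω, ENNReal.ofReal (inner ℂ (delta₀ d) (spectralProjection (H ω) A (delta₀ d))).re ∂P

end Discrete

/-! ### The continuous model: operators in `L²(ℝᵈ)` -/

section Continuous

/-- The Hilbert space `L²(ℝᵈ)`. (Only the measure space structure of `ℝᵈ` matters here, so that
`ℝᵈ` is just the space of functions `Fin d → ℝ` with the Lebesgue measure.) -/
abbrev SpaceL2 (d : ℕ) : Type := Lp ℂ 2 (volume : Measure (Fin d → ℝ))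

/-- A lattice point as a point of `ℝᵈ`. -/
def latticePoint {d : ℕ} (i : Fin d → ℤ) : Fin d → ℝ := fun k => (i k : ℝ)

/-- The translation `(U_i φ)(x) = φ(x - i)`, `i ∈ ℤᵈ`, as a unitary operator in `L²(ℝᵈ)`. -/
def spaceShift {d : ℕ} (i : Fin d → ℤ) : SpaceL2 d ≃ₗᵢ[ℂ] SpaceL2 d where
  toLinearEquiv := LinearEquiv.ofLinearMap
    (Lp.compMeasurePreservingₗ ℂ (fun x => x - latticePoint i)
      (measurePreserving_sub_right volume (latticePoint i)))
    (Lp.compMeasurePreservingₗ ℂ (fun x => x + latticePoint i)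
      (measurePreserving_add_right volume (latticePoint i)))
    (by
      refine LinearMap.ext fun φ => Lp.ext ?_
      have h₁ := measurePreserving_sub_right volume (latticePoint i)
      have h₂ := measurePreserving_add_right volume (latticePoint i)
      refine (Lp.coeFn_compMeasurePreserving (Lp.compMeasurePreserving _ h₂ φ) h₁).trans ?_
      refine (h₁.quasiMeasurePreserving.ae_eq (Lp.coeFn_compMeasurePreserving φ h₂)).trans ?_
      exact .of_forall fun x => by simp)
    (by
      refine LinearMap.ext fun φ => Lp.ext ?_
      have h₁ := measurePreserving_add_right volume (latticePoint i)
      have h₂ := measurePreserving_sub_right volume (latticePoint i)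
      refine (Lp.coeFn_compMeasurePreserving (Lp.compMeasurePreserving _ h₂ φ) h₁).trans ?_
      refine (h₁.quasiMeasurePreserving.ae_eq (Lp.coeFn_compMeasurePreserving φ h₂)).trans ?_
      exact .of_forall fun x => by simp)
  norm_map' φ := Lp.norm_compMeasurePreserving φ _

theorem spaceShift_ae {d : ℕ} (i : Fin d → ℤ) (φ : SpaceL2 d) :
    spaceShift i φ =ᵐ[volume] fun x => φ (x - latticePoint i) :=
  Lp.coeFn_compMeasurePreserving φ _

/-- The multiplication operator `φ ↦ χ_B φ` in `L²(ℝᵈ)`. -/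
def mulIndicator {d : ℕ} (B : Set (Fin d → ℝ)) (hB : MeasurableSet B) :
    SpaceL2 d →L[ℂ] SpaceL2 d :=
  LinearMap.mkContinuous
    { toFun := fun φ => ((Lp.memLp φ).indicator hB).toLp (B.indicator φ)
      map_add' := fun φ ψ => by
        rw [← MemLp.toLp_add, MemLp.toLp_eq_toLp_iff]
        filter_upwards [Lp.coeFn_add φ ψ] with x hx
        rw [Pi.add_apply] at hx
        by_cases h : x ∈ B
        · simp only [Pi.add_apply, Set.indicator_of_mem h]
          exact hx
        · simp [h]
      map_smul' := fun c φ => by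
        rw [RingHom.id_apply, ← MemLp.toLp_const_smul, MemLp.toLp_eq_toLp_iff]
        filter_upwards [Lp.coeFn_smul c φ] with x hx
        rw [Pi.smul_apply] at hx
        by_cases h : x ∈ B
        · simp only [Pi.smul_apply, Set.indicator_of_mem h]
          exact hx
        · simp [h] }
    1
    (fun φ => by
      rw [one_mul]
      change ‖((Lp.memLp φ).indicator hB).toLp (B.indicator φ)‖ ≤ ‖φ‖
      rw [Lp.norm_toLp, Lp.norm_def]
      exact ENNReal.toReal_mono (Lp.eLpNorm_ne_top φ) (eLpNorm_indicator_le _))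

theorem mulIndicator_ae {d : ℕ} (B : Set (Fin d → ℝ)) (hB : MeasurableSet B) (φ : SpaceL2 d) :
    mulIndicator B hB φ =ᵐ[volume] B.indicator φ := by
  have h : mulIndicator B hB φ = ((Lp.memLp φ).indicator hB).toLp (B.indicator φ) := rfl
  rw [h]
  exact MemLp.coeFn_toLp _

/-- The unit cube `Λ = [-1/2, 1/2]ᵈ`. -/
def unitCube (d : ℕ) : Set (Fin d → ℝ) := Set.Icc (fun _ => -1 / 2) (fun _ => 1 / 2)

/-- Multiplication by `χ_Λ`. -/
def cubeIndicator (d : ℕ) : SpaceL2 d →L[ℂ] SpaceL2 d :=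
  mulIndicator (unitCube d) measurableSet_Icc

/-- The density of states measure `ν(A) = 𝔼 tr(χ_Λ E_{H_ω}(A) χ_Λ)` of a Borel set `A`. -/
def continuousDOS {d : ℕ} {Ω : Type*} [MeasurableSpace Ω] (P : Measure Ω)
    (H : Ω → SpaceL2 d →ₗ.[ℂ] SpaceL2 d) (A : Set ℝ) : ℝ≥0∞ :=
  ∫⁻ ω, posTrace (cubeIndicator d * spectralProjection (H ω) A * cubeIndicator d) ∂P

end Continuous

/-- Absolute continuity `ν ≪ γ` of a set function `ν` on the Borel sets with respect to the
measure `γ`. -/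
def AbsCont (ν : Set ℝ → ℝ≥0∞) (γ : Measure ℝ) : Prop :=
  ∀ A, MeasurableSet A → γ A = 0 → ν A = 0

end RandomSpectra

end

/-! The argument shows that a `γ`-null Borel set `A` has `E_{H_ω}(A) = 0` almost surely, and then
reads this inside `M_ω` for `A = I ∩ S`.

If `γ A = 0` then `ν A = 0`, so `⟨x, E_{H_ω}(A) x⟩` has expectation zero for `x = δ₀`, or for `x =
χ_Λ φ` with `φ` in an orthonormal basis. This forces `E_{H_ω}(A) x = 0` almost surely. Covariance
and invariance of `P` carry this to all translates `U_i x`. They are countably many and total, so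
`E_{H_ω}(A) = 0` almost surely (`discreteDOS_eq_zero`, `continuousDOS_eq_zero`). An almost sure
spectrum `S` is closed, so `A = I ∩ S` is an admissible choice. The spectral measures of `H_ω`
restricted to `M_ω` are those of `H_ω` at vectors of `M_ω`, and they live on `S`. Hence they do not
charge `I`, and no interior point of `I` is in the spectrum `S`
(`isClosed_and_interior_inter_eq_empty`). Part (2) is the case `I = ℝ`.

The spectral theory behind this rests on three facts. A self-adjoint `H` has a spectral measure: its
resolvent `R` at `i` is normal, and the continuous functional calculus of `R` with the Riesz
representation theorem yields measures that are transported to the line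
(`exists_isSpectralMeasureOf`). For any spectral measure, `‖(H - z)⁻¹ x‖²` is the integral of `|t -
z|⁻²` (`lintegral_inv_norm_sub_sq`). By Stieltjes inversion these integrals determine the scalar
measures, which gives compatibility with restriction and with unitary conjugation, and measurability
in `ω`. The class `IsSymmetricWithResolvents` is used because it visibly passes to reducing
subspaces. -/

noncomputable section

namespace RandomSpectra

/-! ### Scalar measures of a projection-valued measure and the quadratic form of `H`. -/

section ScalarMeasures

variable {E : Type*} [NormedAddCommGroup E] [InnerProductSpace ℂ E] [CompleteSpace E]

namespace IsProjectionValuedMeasure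

variable {F : Set ℝ → E →L[ℂ] E}

theorem inner_apply_left (hF : IsProjectionValuedMeasure F) {A : Set ℝ} (hA : MeasurableSet A)
    (x y : E) : inner ℂ (F A x) y = inner ℂ x (F A y) := by
  have h := (hF.isStarProjection A hA).isSelfAdjoint
  rw [ContinuousLinearMap.isSelfAdjoint_iff_isSymmetric] at h
  exact h x y

theorem apply_apply (hF : IsProjectionValuedMeasure F) {A B : Set ℝ} (hA : MeasurableSet A)
    (hB : MeasurableSet B) (x : E) : F A (F B x) = F (A ∩ B) x := by
  rw [hF.inter A B hA hB]; rfl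

theorem inner_self_apply (hF : IsProjectionValuedMeasure F) {A : Set ℝ} (hA : MeasurableSet A)
    (x : E) : inner ℂ x (F A x) = ((‖F A x‖ ^ 2 : ℝ) : ℂ) := by
  have h := hF.inner_apply_left hA x (F A x)
  rw [hF.apply_apply hA hA, Set.inter_self] at h
  rw [← h, inner_self_eq_norm_sq_to_K]
  norm_cast

theorem scalarMeasure_apply (hF : IsProjectionValuedMeasure F) {A : Set ℝ} (hA : MeasurableSet A)
    (x : E) : hF.scalarMeasure x A = ENNReal.ofReal (‖F A x‖ ^ 2) := by
  rw [scalarMeasure, Measure.ofMeasurable_apply _ hA, hF.inner_self_apply hA, Complex.ofReal_re]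

theorem scalarMeasure_univ (hF : IsProjectionValuedMeasure F) (x : E) :
    hF.scalarMeasure x Set.univ = ENNReal.ofReal (‖x‖ ^ 2) := by
  rw [hF.scalarMeasure_apply MeasurableSet.univ, hF.univ]; rfl

instance isFiniteMeasure_scalarMeasure (hF : IsProjectionValuedMeasure F) (x : E) :
    IsFiniteMeasure (hF.scalarMeasure x) :=
  ⟨by rw [hF.scalarMeasure_univ]; exact ENNReal.ofReal_lt_top⟩

theorem apply_add_apply_compl (hF : IsProjectionValuedMeasure F) {B : Set ℝ}
    (hB : MeasurableSet B) (y : E) : F B y + F Bᶜ y = y := by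
  have key : ∀ w, inner ℂ w (F B y + F Bᶜ y - y) = 0 := by
    have hs : ∀ x, ‖F B x‖ ^ 2 + ‖F Bᶜ x‖ ^ 2 = ‖x‖ ^ 2 := by
      intro x
      have h := measure_add_measure_compl (μ := hF.scalarMeasure x) hB
      rw [hF.scalarMeasure_apply hB, hF.scalarMeasure_apply hB.compl, hF.scalarMeasure_univ,
        ← ENNReal.ofReal_add (by positivity) (by positivity),
        ENNReal.ofReal_eq_ofReal_iff (by positivity) (by positivity)] at h
      exact h
    have h : ((F B + F Bᶜ : E →L[ℂ] E) : E →ₗ[ℂ] E) = LinearMap.id := by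
      rw [← ext_inner_map]
      intro x
      have h1 := hF.inner_self_apply hB x
      have h2 := hF.inner_self_apply hB.compl x
      rw [← hF.inner_apply_left hB] at h1
      rw [← hF.inner_apply_left hB.compl] at h2
      simp only [ContinuousLinearMap.coe_coe, add_apply, inner_add_left,
        LinearMap.id_apply, h1, h2, inner_self_eq_norm_sq_to_K]
      rw [← Complex.ofReal_add, hs x]
      norm_cast
    intro w
    have := congrArg (fun T : E →ₗ[ℂ] E => T y) h
    simp only [ContinuousLinearMap.coe_coe, add_apply, LinearMap.id_apply] at this
    simp [this]
  exact sub_eq_zero.mp (inner_self_eq_zero.mp (key _))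

/-- The vectors `F (A ∩ B) y` and `F (A ∩ Bᶜ) y` are orthogonal, so no cross term appears. The free
scalars `c`, `d` serve a later polarization. -/
theorem scalarMeasure_apply_add_compl (hF : IsProjectionValuedMeasure F) {B : Set ℝ}
    (hB : MeasurableSet B) (c d : ℂ) (y : E) :
    hF.scalarMeasure (c • F B y + d • F Bᶜ y) =
      ENNReal.ofReal (‖c‖ ^ 2) • (hF.scalarMeasure y).restrict B +
        ENNReal.ofReal (‖d‖ ^ 2) • (hF.scalarMeasure y).restrict Bᶜ := by
  ext A hA
  simp only [Measure.coe_add, Measure.coe_smul, Pi.add_apply, Pi.smul_apply, smul_eq_mul,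
    Measure.restrict_apply hA]
  rw [hF.scalarMeasure_apply hA, hF.scalarMeasure_apply (hA.inter hB),
    hF.scalarMeasure_apply (hA.inter hB.compl), ← ENNReal.ofReal_mul (by positivity),
    ← ENNReal.ofReal_mul (by positivity), ← ENNReal.ofReal_add (by positivity) (by positivity)]
  congr 1
  rw [map_add, map_smul, map_smul, hF.apply_apply hA hB, hF.apply_apply hA hB.compl,
    @norm_add_sq ℂ]
  have h0 : inner ℂ (c • F (A ∩ B) y) (d • F (A ∩ Bᶜ) y) = 0 := by
    rw [inner_smul_left, inner_smul_right, hF.inner_apply_left (hA.inter hB),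
      hF.apply_apply (hA.inter hB) (hA.inter hB.compl)]
    have : A ∩ B ∩ (A ∩ Bᶜ) = ∅ := by ext; simp; tauto
    rw [this, hF.empty]; simp
  rw [h0, norm_smul, norm_smul]
  simp only [map_zero, mul_zero, add_zero]
  ring

theorem scalarMeasure_projection (hF : IsProjectionValuedMeasure F) {B : Set ℝ}
    (hB : MeasurableSet B) (y : E) :
    hF.scalarMeasure (F B y) = (hF.scalarMeasure y).restrict B := by
  simpa using hF.scalarMeasure_apply_add_compl hB 1 0 y

end IsProjectionValuedMeasure

namespace IsSpectralMeasureOf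

variable {F : Set ℝ → E →L[ℂ] E} {H : E →ₗ.[ℂ] E}

theorem pvm (h : IsSpectralMeasureOf H F) : IsProjectionValuedMeasure F := h.1

theorem mem_domain_iff (h : IsSpectralMeasureOf H F) (x : E) :
    x ∈ H.domain ↔ ∫⁻ t, ENNReal.ofReal (t ^ 2) ∂(h.pvm.scalarMeasure x) < ∞ := h.2.1 x

theorem inner_self_apply (h : IsSpectralMeasureOf H F) (x : H.domain) :
    inner ℂ (x : E) (H x) = ((∫ t, t ∂(h.pvm.scalarMeasure (x : E)) : ℝ) : ℂ) := h.2.2 x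

theorem integrable_sq (h : IsSpectralMeasureOf H F) {x : E} (hx : x ∈ H.domain) :
    Integrable (fun t : ℝ => t ^ 2) (h.pvm.scalarMeasure x) := by
  refine ⟨by fun_prop, ?_⟩
  rw [hasFiniteIntegral_iff_ofReal (.of_forall fun t => by positivity)]
  exact (h.mem_domain_iff x).1 hx

theorem integrable_id (h : IsSpectralMeasureOf H F) {x : E} (hx : x ∈ H.domain) :
    Integrable (fun t : ℝ => t) (h.pvm.scalarMeasure x) := by
  refine ((h.integrable_sq hx).add (integrable_const (1 : ℝ))).mono' (by fun_prop)
    (.of_forall fun t => ?_)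
  rw [Real.norm_eq_abs, Pi.add_apply]
  nlinarith [sq_abs t, sq_nonneg (|t| - 1), abs_nonneg t]

theorem combination_mem_domain (h : IsSpectralMeasureOf H F) {B : Set ℝ} (hB : MeasurableSet B)
    (c d : ℂ) {y : E} (hy : y ∈ H.domain) : c • F B y + d • F Bᶜ y ∈ H.domain := by
  rw [h.mem_domain_iff, h.pvm.scalarMeasure_apply_add_compl hB, lintegral_add_measure,
    lintegral_smul_measure, lintegral_smul_measure]
  have hy' := (h.mem_domain_iff y).1 hy
  refine ENNReal.add_lt_top.2 ⟨?_, ?_⟩ <;>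
  · refine ENNReal.mul_lt_top ENNReal.ofReal_lt_top ?_
    exact (lintegral_mono' Measure.restrict_le_self le_rfl).trans_lt hy'

theorem projection_mem_domain (h : IsSpectralMeasureOf H F) {B : Set ℝ} (hB : MeasurableSet B)
    {y : E} (hy : y ∈ H.domain) : F B y ∈ H.domain := by
  simpa using h.combination_mem_domain hB 1 0 hy

theorem projection_mem_domain_of_bounded (h : IsSpectralMeasureOf H F) {B : Set ℝ}
    (hB : MeasurableSet B) {C : ℝ} (hC : ∀ t ∈ B, |t| ≤ C) (y : E) : F B y ∈ H.domain := by
  rw [h.mem_domain_iff, h.pvm.scalarMeasure_projection hB]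
  calc ∫⁻ t in B, ENNReal.ofReal (t ^ 2) ∂(h.pvm.scalarMeasure y)
      ≤ ∫⁻ _ in B, ENNReal.ofReal (C ^ 2) ∂(h.pvm.scalarMeasure y) :=
        setLIntegral_mono measurable_const fun t ht =>
          ENNReal.ofReal_le_ofReal (by rw [← sq_abs t]; gcongr; exact hC t ht)
    _ < ∞ := by
        rw [setLIntegral_const]
        exact ENNReal.mul_lt_top ENNReal.ofReal_lt_top (measure_lt_top _ _)

theorem inner_combination (h : IsSpectralMeasureOf H F) {B : Set ℝ} (hB : MeasurableSet B)
    (c d : ℂ) (y : H.domain) (w : H.domain) (hw : (w : E) = c • F B y + d • F Bᶜ y) :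
    inner ℂ (w : E) (H w) = ((‖c‖ ^ 2 * ∫ t in B, t ∂(h.pvm.scalarMeasure (y : E)) +
      ‖d‖ ^ 2 * ∫ t in Bᶜ, t ∂(h.pvm.scalarMeasure (y : E)) : ℝ) : ℂ) := by
  have hi := h.integrable_id y.2
  rw [h.inner_self_apply, hw, h.pvm.scalarMeasure_apply_add_compl hB, integral_add_measure,
    integral_smul_measure, integral_smul_measure, ENNReal.toReal_ofReal (by positivity),
    ENNReal.toReal_ofReal (by positivity), smul_eq_mul, smul_eq_mul]
  · exact hi.restrict.smul_measure ENNReal.ofReal_ne_top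
  · exact hi.restrict.smul_measure ENNReal.ofReal_ne_top

/-- The definition of a spectral measure only gives diagonal values `⟨x, H x⟩`. The quadratic form
has no cross terms on combinations of `u = F B y` and `v = F Bᶜ y`; testing `u + v` and `i u + v`
shows that the real and the imaginary part of `⟨u, H v⟩` vanish. -/
theorem inner_projection_apply (h : IsSpectralMeasureOf H F) (hs : H.IsFormalAdjoint H)
    {B : Set ℝ} (hB : MeasurableSet B) (y : H.domain) :
    inner ℂ (F B y) (H y) = ((∫ t in B, t ∂(h.pvm.scalarMeasure (y : E)) : ℝ) : ℂ) := by
  set u : H.domain := ⟨F B y, h.projection_mem_domain hB y.2⟩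
  set v : H.domain := ⟨F Bᶜ y, h.projection_mem_domain hB.compl y.2⟩
  have huv : u + v = y := Subtype.ext (h.pvm.apply_add_apply_compl hB y)
  have hu := h.inner_combination hB 1 0 y u (by simp [u])
  have hv := h.inner_combination hB 0 1 y v (by simp [v])
  have h1 := h.inner_combination hB 1 1 y (u + v) (by simp [u, v])
  have h2 := h.inner_combination hB I 1 y (I • u + v) (by simp [u, v])
  have hcross : inner ℂ (v : E) (H u) = (starRingEnd ℂ) (inner ℂ (u : E) (H v)) := by
    rw [← hs v u, inner_conj_symm]
  simp only [LinearPMap.map_add, LinearPMap.map_smul, Submodule.coe_add, Submodule.coe_smul,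
    inner_add_left, inner_add_right, inner_smul_left, inner_smul_right, hu, hv, hcross] at h1 h2
  have hz : inner ℂ (u : E) (H v) = 0 := by
    generalize inner ℂ (u : E) (H v) = w at h1 h2 ⊢
    apply Complex.ext
    · have := congrArg Complex.re h1
      simp at this
      simp
      linarith
    · have := congrArg Complex.re h2
      simp at this
      simp
      linarith
  change inner ℂ (u : E) (H y) = _
  have hy : H y = H u + H v := by rw [← H.map_add, huv]
  rw [hy, inner_add_right, hz, hu]
  simp

end IsSpectralMeasureOf

end ScalarMeasures

/-! ### The scalar measure of `(H - z) y` and the norm of the resolvent. -/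

section ScalarMeasuresOfShift

variable {E : Type*} [NormedAddCommGroup E] [InnerProductSpace ℂ E] [CompleteSpace E]

namespace IsSpectralMeasureOf

variable {F : Set ℝ → E →L[ℂ] E} {H : E →ₗ.[ℂ] E}

theorem polarization (h : IsSpectralMeasureOf H F) (hs : H.IsFormalAdjoint H) (x y : H.domain) :
    ∫ t, t ∂(h.pvm.scalarMeasure ((x : E) + y)) - ∫ t, t ∂(h.pvm.scalarMeasure ((x : E) - y)) =
      4 * (inner ℂ (x : E) (H y)).re := by
  have h1 := h.inner_self_apply (x + y)
  have h2 := h.inner_self_apply (x - y)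
  have hc : (inner ℂ (y : E) (H x)).re = (inner ℂ (x : E) (H y)).re := by
    rw [← hs y x, ← inner_conj_symm, Complex.conj_re]
  simp only [LinearPMap.map_add, LinearPMap.map_sub, Submodule.coe_add, Submodule.coe_sub,
    inner_add_left, inner_add_right, inner_sub_left, inner_sub_right] at h1 h2
  have e1 := congrArg Complex.re h1
  have e2 := congrArg Complex.re h2
  simp only [Complex.add_re, Complex.sub_re, Complex.ofReal_re] at e1 e2
  linarith

/-- Polarization on the level of measures: the scalar measures of `F A (H y) ± y` differ by `4 t`
times that of `y` on `A`. Adding `4 C` times the latter to both sides makes the density nonnegative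
and keeps the identity among positive measures. -/
theorem scalarMeasure_add_smul (h : IsSpectralMeasureOf H F) (hs : H.IsFormalAdjoint H)
    {A : Set ℝ} (hA : MeasurableSet A) {C : ℝ} (hC0 : 0 ≤ C) (hC : ∀ t ∈ A, |t| ≤ C)
    (y : H.domain) :
    h.pvm.scalarMeasure (F A (H y) + y) +
        ENNReal.ofReal (4 * C) • (h.pvm.scalarMeasure (y : E)).restrict A =
      h.pvm.scalarMeasure (F A (H y) - y) +
        ((h.pvm.scalarMeasure (y : E)).restrict A).withDensity
          (fun t => ENNReal.ofReal (4 * (t + C))) := by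
  have hi := h.integrable_id y.2
  ext B hB
  have hAB := hB.inter hA
  simp only [Measure.coe_add, Measure.coe_smul, Pi.add_apply, Pi.smul_apply, smul_eq_mul]
  rw [withDensity_apply _ hB, Measure.restrict_restrict hB, Measure.restrict_apply hB,
    h.pvm.scalarMeasure_apply hB, h.pvm.scalarMeasure_apply hB,
    ← ofReal_integral_eq_lintegral_ofReal, ← ENNReal.ofReal_add (by positivity),
    ← ofReal_measureReal, ← ENNReal.ofReal_mul (by positivity),
    ← ENNReal.ofReal_add (by positivity) (by positivity)]
  · congr 1
    rw [integral_const_mul, integral_add hi.restrict (integrable_const _), integral_const,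
      measureReal_restrict_apply_univ, map_add, map_sub, @norm_add_sq ℂ, @norm_sub_sq ℂ]
    have hr : (RCLike.re (inner ℂ (F B (F A (H y))) (F B (y : E))) : ℝ) =
        ∫ t in B ∩ A, t ∂(h.pvm.scalarMeasure (y : E)) := by
      have h1 := h.inner_projection_apply hs hAB y
      rw [h.pvm.apply_apply hB hA, h.pvm.inner_apply_left hAB, h.pvm.apply_apply hAB hB]
      have : B ∩ A ∩ B = B ∩ A := by ext; simp; tauto
      rw [this, ← inner_conj_symm, h1]
      simp
    rw [hr, smul_eq_mul]
    ring
  · refine setIntegral_nonneg hAB fun t ht => ?_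
    have := neg_abs_le t
    have := hC t ht.2
    linarith
  · exact (hi.restrict.add (integrable_const _)).const_mul _
  · filter_upwards [ae_restrict_mem hAB] with t ht
    have := neg_abs_le t
    have := hC t ht.2
    simp only [Pi.zero_apply]
    linarith

/-- Integrating `t` against the preceding identity of measures gives `4 Re ⟨F A (H y), H y⟩` on one
side, by polarization, and four times the integral of `t²` on the other. Boundedness of `A` puts `F
A (H y)` in the domain. -/
theorem norm_sq_projection_apply_of_bounded (h : IsSpectralMeasureOf H F)
    (hs : H.IsFormalAdjoint H) {A : Set ℝ} (hA : MeasurableSet A) {C : ℝ} (hC0 : 0 ≤ C)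
    (hC : ∀ t ∈ A, |t| ≤ C) (y : H.domain) :
    ‖F A (H y)‖ ^ 2 = ∫ t in A, t ^ 2 ∂(h.pvm.scalarMeasure (y : E)) := by
  set x : H.domain := ⟨F A (H y), h.projection_mem_domain_of_bounded hA hC (H y)⟩ with hx
  have hi := h.integrable_id y.2
  have hi2 := h.integrable_sq y.2
  have hpos : ∀ t ∈ A, 0 ≤ 4 * (t + C) := fun t ht => by
    have := neg_abs_le t
    have := hC t ht
    linarith
  have hint : Integrable (fun t : ℝ => (4 * (t + C)) * t)
      ((h.pvm.scalarMeasure (y : E)).restrict A) := by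
    refine (((hi2.const_mul 4).add (hi.const_mul (4 * C))).restrict (s := A)).congr
      (.of_forall fun t => ?_)
    simp only [Pi.add_apply]
    ring
  have hae : (fun t : ℝ => (ENNReal.ofReal (4 * (t + C))).toReal • t) =ᵐ[
      (h.pvm.scalarMeasure (y : E)).restrict A] fun t => (4 * (t + C)) * t := by
    filter_upwards [ae_restrict_mem hA] with t ht
    rw [ENNReal.toReal_ofReal (hpos t ht), smul_eq_mul]
  have hm : Measurable fun t : ℝ => ENNReal.ofReal (4 * (t + C)) := by fun_prop
  have key := congrArg (fun μ : Measure ℝ => ∫ t, t ∂μ) (h.scalarMeasure_add_smul hs hA hC0 hC y)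
  have hip : Integrable (fun t => t) (h.pvm.scalarMeasure (F A (H y) + y)) :=
    h.integrable_id (x + y).2
  have him : Integrable (fun t => t) (h.pvm.scalarMeasure (F A (H y) - y)) :=
    h.integrable_id (x - y).2
  rw [integral_add_measure hip
      (hi.restrict.smul_measure ENNReal.ofReal_ne_top),
    integral_add_measure him, integral_smul_measure,
    integral_withDensity_eq_integral_toReal_smul hm (.of_forall fun _ => ENNReal.ofReal_lt_top),
    integral_congr_ae hae, ENNReal.toReal_ofReal (by positivity)] at key
  · have hp := h.polarization hs x y
    simp only [hx] at hp
    have hr : (inner ℂ (F A (H y)) (H y)).re = ‖F A (H y)‖ ^ 2 := by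
      rw [h.pvm.inner_apply_left hA, h.pvm.inner_self_apply hA, Complex.ofReal_re]
    have hsplit : ∫ t in A, (4 * (t + C)) * t ∂(h.pvm.scalarMeasure (y : E)) =
        4 * ∫ t in A, t ^ 2 ∂(h.pvm.scalarMeasure (y : E)) +
          4 * C * ∫ t in A, t ∂(h.pvm.scalarMeasure (y : E)) := by
      rw [← integral_const_mul, ← integral_const_mul,
        ← integral_add (hi2.restrict.const_mul _) (hi.restrict.const_mul _)]
      congr 1
      ext t
      ring
    rw [hsplit, smul_eq_mul] at key
    rw [hr] at hp
    linarith
  · rw [integrable_withDensity_iff_integrable_smul' hm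
      (.of_forall fun _ => ENNReal.ofReal_lt_top)]
    exact hint.congr hae.symm

/-- For `y ∈ D(H)`, the scalar spectral measure of `(H - z) y` is `|t - z|²` times that of `y`. -/
theorem scalarMeasure_sub_smul (h : IsSpectralMeasureOf H F) (hs : H.IsFormalAdjoint H)
    (y : H.domain) (z : ℂ) :
    h.pvm.scalarMeasure (H y - z • (y : E)) =
      (h.pvm.scalarMeasure (y : E)).withDensity fun t => ENNReal.ofReal (‖(t : ℂ) - z‖ ^ 2) := by
  have hi := h.integrable_id y.2
  have hi2 := h.integrable_sq y.2
  -- The formula for `‖F A (H y)‖²` is known for bounded `A` only, hence the exhaustion of the line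
  -- by compact intervals.
  have key : ∀ n : ℕ, (h.pvm.scalarMeasure (H y - z • (y : E))).restrict (Set.Icc (-n : ℝ) n) =
      ((h.pvm.scalarMeasure (y : E)).withDensity
        fun t => ENNReal.ofReal (‖(t : ℂ) - z‖ ^ 2)).restrict (Set.Icc (-n : ℝ) n) := by
    intro n
    ext B hB
    have hA : MeasurableSet (B ∩ Set.Icc (-n : ℝ) n) := hB.inter measurableSet_Icc
    rw [Measure.restrict_apply hB, Measure.restrict_apply hB, withDensity_apply _ hA,
      h.pvm.scalarMeasure_apply hA]
    generalize hAdef : B ∩ Set.Icc (-n : ℝ) n = A at hA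
    have hC : ∀ t ∈ A, |t| ≤ n := fun t ht => by
      rw [← hAdef] at ht
      exact abs_le.2 ht.2
    have he : ∀ t : ℝ, ‖(t : ℂ) - z‖ ^ 2 = t ^ 2 - 2 * z.re * t + ‖z‖ ^ 2 := fun t => by
      rw [← Complex.normSq_eq_norm_sq, ← Complex.normSq_eq_norm_sq, Complex.normSq_apply,
        Complex.normSq_apply]
      simp
      ring
    have h1 := h.norm_sq_projection_apply_of_bounded hs hA n.cast_nonneg hC y
    have h2 := h.inner_projection_apply hs hA y
    have h3 : inner ℂ (F A (H y)) (F A (y : E)) =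
        ((∫ t in A, t ∂(h.pvm.scalarMeasure (y : E)) : ℝ) : ℂ) := by
      rw [h.pvm.inner_apply_left hA, h.pvm.apply_apply hA hA, Set.inter_self, ← inner_conj_symm,
        h2, Complex.conj_ofReal]
    have h4 : ‖F A (y : E)‖ ^ 2 = (h.pvm.scalarMeasure (y : E)).real A := by
      rw [measureReal_def, h.pvm.scalarMeasure_apply hA, ENNReal.toReal_ofReal (by positivity)]
    have hint : Integrable (fun t : ℝ => ‖(t : ℂ) - z‖ ^ 2)
        ((h.pvm.scalarMeasure (y : E)).restrict A) := by
      simp only [he]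
      exact ((hi2.restrict.sub (hi.restrict.const_mul _)).add (integrable_const _))
    rw [← ofReal_integral_eq_lintegral_ofReal hint (.of_forall fun t => by positivity)]
    congr 1
    simp only [he]
    rw [integral_add ?_ (integrable_const _), integral_sub hi2.restrict (hi.restrict.const_mul _),
      integral_const_mul, integral_const,
      measureReal_restrict_apply_univ, smul_eq_mul, ← h1, ← h4, map_sub, map_smul,
      @norm_sub_sq ℂ, inner_smul_right, h3, norm_smul]
    · simp
      ring
    · exact hi2.restrict.sub (hi.restrict.const_mul _)
  rw [Measure.ext_iff_of_iUnion_eq_univ (s := fun n : ℕ => Set.Icc (-n : ℝ) n)]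
  · exact key
  · refine Set.eq_univ_of_forall fun t => Set.mem_iUnion.2 ?_
    obtain ⟨n, hn⟩ := exists_nat_ge |t|
    exact ⟨n, abs_le.1 hn⟩

theorem ofReal_norm_sub_smul_sq (h : IsSpectralMeasureOf H F) (hs : H.IsFormalAdjoint H)
    (y : H.domain) (z : ℂ) :
    ENNReal.ofReal (‖H y - z • (y : E)‖ ^ 2) =
      ∫⁻ t : ℝ, ENNReal.ofReal (‖(t : ℂ) - z‖ ^ 2) ∂(h.pvm.scalarMeasure (y : E)) := by
  rw [← h.pvm.scalarMeasure_univ, h.scalarMeasure_sub_smul hs,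
    withDensity_apply _ MeasurableSet.univ, Measure.restrict_univ]

/-- `‖(H - z)⁻¹ x‖² = ∫ |t - z|⁻² d⟨x, F(t) x⟩`. -/
theorem lintegral_inv_norm_sub_sq (h : IsSpectralMeasureOf H F) (hs : H.IsFormalAdjoint H)
    {z : ℂ} (hz : z.im ≠ 0) {R : E →L[ℂ] E} (hR : IsResolventAt H z R) (x : E) :
    ∫⁻ t : ℝ, ENNReal.ofReal ((‖(t : ℂ) - z‖ ^ 2)⁻¹) ∂(h.pvm.scalarMeasure x) =
      ENNReal.ofReal (‖R x‖ ^ 2) := by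
  obtain ⟨hd, hx⟩ := hR.1 x
  have hm : Measurable fun t : ℝ => ENNReal.ofReal (‖(t : ℂ) - z‖ ^ 2) := by fun_prop
  -- Since `x = (H - z) R x`, the measure of `x` has density `|t - z|²` with respect to that of `R
  -- x`; the integrand cancels it.
  have hsm := h.scalarMeasure_sub_smul hs ⟨R x, hd⟩ z
  simp only [hx] at hsm
  rw [hsm, lintegral_withDensity_eq_lintegral_mul _ hm (by fun_prop)]
  have : ∀ t : ℝ, ((fun t : ℝ => ENNReal.ofReal (‖(t : ℂ) - z‖ ^ 2)) * fun t : ℝ =>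
      ENNReal.ofReal ((‖(t : ℂ) - z‖ ^ 2)⁻¹)) t = 1 := fun t => by
    have hne : ‖(t : ℂ) - z‖ ^ 2 ≠ 0 := by
      have : (t : ℂ) - z ≠ 0 := fun h0 => hz (by simpa using (congrArg Complex.im h0).symm)
      simpa using this
    rw [Pi.mul_apply, ← ENNReal.ofReal_mul (by positivity), mul_inv_cancel₀ hne, ENNReal.ofReal_one]
  simp only [this]
  rw [lintegral_one, h.pvm.scalarMeasure_univ]

end IsSpectralMeasureOf

end ScalarMeasuresOfShift

/-! ### Poisson integrals determine finite measures. -/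

section StieltjesInversion

open Filter Topology

/-- The Poisson integral of `μ` at the point `s + iε` of the upper half plane. -/
def poissonIntegral (μ : Measure ℝ) (ε s : ℝ) : ℝ≥0∞ :=
  ENNReal.ofReal (ε / Real.pi) *
    ∫⁻ t : ℝ, ENNReal.ofReal ((‖(t : ℂ) - (s + ε * I)‖ ^ 2)⁻¹) ∂μ

theorem norm_ofReal_sub_sq (t s ε : ℝ) : ‖(t : ℂ) - (s + ε * I)‖ ^ 2 = (t - s) ^ 2 + ε ^ 2 := by
  rw [← Complex.normSq_eq_norm_sq, Complex.normSq_apply]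
  simp
  ring

theorem setLIntegral_cauchy_kernel {ε a b : ℝ} (hε : 0 < ε) (hab : a ≤ b) (t : ℝ) :
    ∫⁻ s in Set.Ioc a b, ENNReal.ofReal (ε / Real.pi) *
        ENNReal.ofReal ((‖(t : ℂ) - (s + ε * I)‖ ^ 2)⁻¹) =
      ENNReal.ofReal ((Real.arctan ((b - t) / ε) - Real.arctan ((a - t) / ε)) / Real.pi) := by
  have hd : ∀ s : ℝ, HasDerivAt (fun s => Real.arctan ((s - t) / ε) / Real.pi)
      (ε / Real.pi * ((t - s) ^ 2 + ε ^ 2)⁻¹) s := by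
    intro s
    have h1 : HasDerivAt (fun s => (s - t) / ε) (1 / ε) s :=
      ((hasDerivAt_id s).sub_const t).div_const ε
    refine (h1.arctan.div_const Real.pi).congr_deriv ?_
    have : (t - s) ^ 2 + ε ^ 2 ≠ 0 := by positivity
    have h2 : 1 + ((s - t) / ε) ^ 2 ≠ 0 := by positivity
    have h3 : 1 + ((s - t) / ε) ^ 2 = ((t - s) ^ 2 + ε ^ 2) / ε ^ 2 := by field_simp; ring
    rw [h3]
    field_simp
  have hc : Continuous fun s : ℝ => ε / Real.pi * ((t - s) ^ 2 + ε ^ 2)⁻¹ := by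
    refine continuous_const.mul (Continuous.inv₀ (by fun_prop) fun s => ?_)
    positivity
  have hint := intervalIntegral.integral_eq_sub_of_hasDerivAt (a := a) (b := b) (fun s _ => hd s)
    (hc.intervalIntegrable a b)
  rw [intervalIntegral.integral_of_le hab] at hint
  rw [sub_div, ← hint, ofReal_integral_eq_lintegral_ofReal hc.integrableOn_Ioc
    (.of_forall fun s => by positivity)]
  refine lintegral_congr fun s => ?_
  rw [← ENNReal.ofReal_mul (by positivity), norm_ofReal_sub_sq]

theorem setLIntegral_poissonIntegral (μ : Measure ℝ) [IsFiniteMeasure μ] {ε a b : ℝ} (hε : 0 < ε)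
    (hab : a ≤ b) :
    ∫⁻ s in Set.Ioc a b, poissonIntegral μ ε s =
      ∫⁻ t, ENNReal.ofReal
        ((Real.arctan ((b - t) / ε) - Real.arctan ((a - t) / ε)) / Real.pi) ∂μ := by
  have h1 : ∀ s, poissonIntegral μ ε s = ∫⁻ t : ℝ, ENNReal.ofReal (ε / Real.pi) *
      ENNReal.ofReal ((‖(t : ℂ) - (s + ε * I)‖ ^ 2)⁻¹) ∂μ := fun s => by
    rw [poissonIntegral, lintegral_const_mul _ (by fun_prop)]
  simp only [h1]
  rw [lintegral_lintegral_swap (by fun_prop)]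
  exact lintegral_congr fun t => setLIntegral_cauchy_kernel hε hab t

/-- The kernel has width `m⁻²`, while the endpoint is moved to the right by the larger amount `m⁻¹`.
This is why `t = b` falls on the side of the limit `π / 2`, so that an atom at `b` is counted in
full. -/
theorem tendsto_arctan_div (b t : ℝ) :
    Tendsto (fun m : ℝ => Real.arctan ((b + m⁻¹ - t) / (m ^ 2)⁻¹)) atTop
      (𝓝 (if t ≤ b then Real.pi / 2 else -(Real.pi / 2))) := by
  have he : (fun m : ℝ => (b + m⁻¹ - t) / (m ^ 2)⁻¹) =ᶠ[atTop]
      fun m => m * ((b - t) * m + 1) := by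
    filter_upwards [eventually_gt_atTop 0] with m hm
    field_simp
    ring
  split_ifs with h
  · refine (tendsto_nhds_of_tendsto_nhdsWithin Real.tendsto_arctan_atTop).comp ?_
    refine Tendsto.congr' he.symm (tendsto_atTop_mono' _ ?_ tendsto_id)
    filter_upwards [eventually_gt_atTop 0] with m hm
    have : 0 ≤ m * ((b - t) * m) := mul_nonneg hm.le (mul_nonneg (by linarith) hm.le)
    simp only [id]
    linarith
  · refine (tendsto_nhds_of_tendsto_nhdsWithin Real.tendsto_arctan_atBot).comp ?_
    refine Tendsto.congr' he.symm (tendsto_id.atTop_mul_atBot₀ ?_)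
    exact tendsto_atBot_add_const_right _ _
      (tendsto_id.const_mul_atTop_of_neg (by push Not at h; linarith))

theorem tendsto_arctan_div_neg (t : ℝ) :
    Tendsto (fun m : ℝ => Real.arctan ((-m - t) / (m ^ 2)⁻¹)) atTop (𝓝 (-(Real.pi / 2))) := by
  refine (tendsto_nhds_of_tendsto_nhdsWithin Real.tendsto_arctan_atBot).comp ?_
  simp only [div_inv_eq_mul]
  refine Tendsto.atBot_mul_atTop₀ ?_ (tendsto_pow_atTop two_ne_zero)
  exact tendsto_atBot_add_const_right _ (-t) tendsto_neg_atTop_atBot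

/-- **Stieltjes inversion**: the distribution function of a finite measure is a limit of integrals
of its Poisson integrals. -/
theorem tendsto_setLIntegral_poissonIntegral (μ : Measure ℝ) [IsFiniteMeasure μ] (b : ℝ) :
    Tendsto (fun m : ℕ => ∫⁻ s in Set.Ioc (-(m : ℝ)) (b + (m : ℝ)⁻¹),
      poissonIntegral μ (((m : ℝ) ^ 2)⁻¹) s) atTop (𝓝 (μ (Set.Iic b))) := by
  have hev : ∀ᶠ m : ℕ in atTop, 0 < (m : ℝ) ∧ -(m : ℝ) ≤ b + (m : ℝ)⁻¹ := by
    filter_upwards [tendsto_natCast_atTop_atTop.eventually_gt_atTop (0 : ℝ),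
      tendsto_natCast_atTop_atTop.eventually_ge_atTop (-b)] with m h1 h2
    have : 0 < (m : ℝ)⁻¹ := inv_pos.2 h1
    exact ⟨h1, by linarith⟩
  have hcongr : ∀ᶠ m : ℕ in atTop, ∫⁻ t, ENNReal.ofReal
      ((Real.arctan ((b + (m : ℝ)⁻¹ - t) / ((m : ℝ) ^ 2)⁻¹) -
        Real.arctan ((-(m : ℝ) - t) / ((m : ℝ) ^ 2)⁻¹)) / Real.pi) ∂μ =
      ∫⁻ s in Set.Ioc (-(m : ℝ)) (b + (m : ℝ)⁻¹), poissonIntegral μ (((m : ℝ) ^ 2)⁻¹) s := by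
    filter_upwards [hev] with m hm
    have := hm.1
    exact (setLIntegral_poissonIntegral μ (by positivity) hm.2).symm
  refine Tendsto.congr' hcongr ?_
  have hlim : μ (Set.Iic b) = ∫⁻ t, (Set.Iic b).indicator 1 t ∂μ :=
    (lintegral_indicator_one measurableSet_Iic).symm
  rw [hlim]
  refine tendsto_lintegral_of_dominated_convergence (fun _ => 1) (fun m => ?_) (fun m => ?_)
    (by simp) ?_
  · fun_prop
  · refine .of_forall fun t => ?_
    rw [← ENNReal.ofReal_one]
    refine ENNReal.ofReal_le_ofReal ((div_le_one Real.pi_pos).2 ?_)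
    have h1 := Real.arctan_lt_pi_div_two ((b + (m : ℝ)⁻¹ - t) / ((m : ℝ) ^ 2)⁻¹)
    have h2 := Real.neg_pi_div_two_lt_arctan ((-(m : ℝ) - t) / ((m : ℝ) ^ 2)⁻¹)
    linarith
  · refine .of_forall fun t => ?_
    have h := (ENNReal.tendsto_ofReal (((tendsto_arctan_div b t).sub
      (tendsto_arctan_div_neg t)).div_const Real.pi)).comp tendsto_natCast_atTop_atTop
    have he : (Set.Iic b).indicator 1 t = ENNReal.ofReal
        (((if t ≤ b then Real.pi / 2 else -(Real.pi / 2)) - -(Real.pi / 2)) / Real.pi) := by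
      by_cases htb : t ≤ b
      · simp [htb, Real.pi_ne_zero]
      · simp [htb]
    rw [he]
    exact h

theorem ext_of_poissonIntegral {μ ν : Measure ℝ} [IsFiniteMeasure μ] [IsFiniteMeasure ν]
    (h : ∀ ε s : ℝ, 0 < ε → poissonIntegral μ ε s = poissonIntegral ν ε s) : μ = ν := by
  refine Measure.ext_of_Iic μ ν fun b => ?_
  refine tendsto_nhds_unique (tendsto_setLIntegral_poissonIntegral μ b)
    (Tendsto.congr' ?_ (tendsto_setLIntegral_poissonIntegral ν b))
  filter_upwards [eventually_gt_atTop 0] with m hm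
  exact lintegral_congr fun s => (h _ s (by positivity)).symm

/-- The kernel is dominated by `ε⁻²`. Continuity in `s` upgrades measurability in `ω` for each `s`
to joint measurability. -/
theorem continuous_poissonIntegral (μ : Measure ℝ) [IsFiniteMeasure μ] {ε : ℝ} (hε : 0 < ε) :
    Continuous (poissonIntegral μ ε) := by
  refine ENNReal.continuous_const_mul ENNReal.ofReal_ne_top |>.comp ?_
  refine continuous_iff_continuousAt.2 fun s₀ => ?_
  refine tendsto_lintegral_filter_of_dominated_convergence
    (fun _ => ENNReal.ofReal ((ε ^ 2)⁻¹)) (.of_forall fun s => by fun_prop)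
    (.of_forall fun s => .of_forall fun t => ?_) ?_ (.of_forall fun t => ?_)
  · rw [norm_ofReal_sub_sq]
    refine ENNReal.ofReal_le_ofReal (inv_anti₀ (by positivity) ?_)
    nlinarith [sq_nonneg (t - s)]
  · rw [lintegral_const]
    exact (ENNReal.mul_lt_top ENNReal.ofReal_lt_top (measure_lt_top _ _)).ne
  · simp only [norm_ofReal_sub_sq]
    refine ENNReal.tendsto_ofReal (Tendsto.inv₀ ?_ (by positivity))
    exact Continuous.tendsto (by fun_prop) s₀

/-- A family of finite measures is measurable if its total masses and Poisson integrals are. -/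
theorem measurable_of_measurable_poissonIntegral {Ω : Type*} [MeasurableSpace Ω]
    {μ : Ω → Measure ℝ} [∀ ω, IsFiniteMeasure (μ ω)]
    (huniv : Measurable fun ω => μ ω Set.univ)
    (h : ∀ ε s : ℝ, 0 < ε → Measurable fun ω => poissonIntegral (μ ω) ε s) : Measurable μ := by
  refine Measurable.measure_of_isPiSystem (borel_eq_generateFrom_Iic ℝ ▸ BorelSpace.measurable_eq)
    isPiSystem_Iic ?_ huniv
  rintro _ ⟨b, rfl⟩
  refine measurable_of_tendsto_metrizable (fun m : ℕ => ?_)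
    (tendsto_pi_nhds.2 fun ω => tendsto_setLIntegral_poissonIntegral (μ ω) b)
  rcases m.eq_zero_or_pos with rfl | hm
  -- For `m = 0` the convention `0⁻¹ = 0` gives `ε = 0`, and the prefactor makes the Poisson
  -- integral vanish.
  · simp [poissonIntegral]
  · have hε : 0 < ((m : ℝ) ^ 2)⁻¹ := by positivity
    exact Measurable.lintegral_prod_left' (measurable_uncurry_of_continuous_of_measurable
      (fun ω => continuous_poissonIntegral (μ ω) hε) fun s => h _ s hε)

end StieltjesInversion

theorem inner_self_eq_ofReal {E : Type*} [NormedAddCommGroup E] [InnerProductSpace ℂ E] (x : E) :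
    inner ℂ x x = ((‖x‖ ^ 2 : ℝ) : ℂ) := by
  rw [inner_self_eq_norm_sq_to_K]
  norm_cast

/-! ### Projection-valued measures from a representation of `C(X)`. -/

section Construction

variable {E : Type*} [NormedAddCommGroup E] [InnerProductSpace ℂ E] [CompleteSpace E]

open Filter Topology

/-- A family of operators is a projection-valued measure as soon as the inner products
`⟪F A x, F B x⟫` and `⟪x, F A x⟫` are given by finite measures of total mass `‖x‖²`. -/
theorem IsProjectionValuedMeasure.of_measures {F : Set ℝ → E →L[ℂ] E} {μ : E → Measure ℝ}
    [∀ x, IsFiniteMeasure (μ x)]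
    (h₁ : ∀ A, MeasurableSet A → ∀ x, inner ℂ x (F A x) = ((μ x).real A : ℂ))
    (h₂ : ∀ A B, MeasurableSet A → MeasurableSet B → ∀ x,
      inner ℂ (F A x) (F B x) = ((μ x).real (A ∩ B) : ℂ))
    (huniv : ∀ x, (μ x).real Set.univ = ‖x‖ ^ 2) : IsProjectionValuedMeasure F := by
  have h₁' : ∀ A, MeasurableSet A → ∀ x, inner ℂ (F A x) x = ((μ x).real A : ℂ) := by
    intro A hA x
    rw [← inner_conj_symm, h₁ A hA, Complex.conj_ofReal]
  have hsymm : ∀ A, MeasurableSet A → ((F A : E →L[ℂ] E) : E →ₗ[ℂ] E).IsSymmetric := by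
    intro A hA
    rw [LinearMap.isSymmetric_iff_inner_map_self_real]
    intro x
    rw [ContinuousLinearMap.coe_coe, h₁' A hA, Complex.conj_ofReal]
  have hmul : ∀ A B, MeasurableSet A → MeasurableSet B → F (A ∩ B) = F A * F B := by
    intro A B hA hB
    apply ContinuousLinearMap.coe_injective
    rw [← ext_inner_map]
    intro x
    change inner ℂ (F (A ∩ B) x) x = inner ℂ (F A (F B x)) x
    rw [h₁' _ (hA.inter hB)]
    have := hsymm A hA (F B x) x
    simp only [ContinuousLinearMap.coe_coe] at this
    rw [this, h₂ B A hB hA, Set.inter_comm]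
  refine ⟨fun A hA => ⟨?_, ?_⟩, ?_, hmul, ?_⟩
  · rw [IsIdempotentElem, ← hmul A A hA hA, Set.inter_self]
  · rw [ContinuousLinearMap.isSelfAdjoint_iff_isSymmetric]
    exact hsymm A hA
  · apply ContinuousLinearMap.coe_injective
    rw [← ext_inner_map]
    intro x
    change inner ℂ (F Set.univ x) x = inner ℂ x x
    rw [h₁' _ MeasurableSet.univ, huniv, inner_self_eq_norm_sq_to_K]
    norm_cast
  · intro A hA hd x
    have hU : MeasurableSet (⋃ n, A n) := MeasurableSet.iUnion hA
    -- The square of the norm of the remainder is the mass not yet covered, so strong convergence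
    -- reduces to countable additivity of `μ x`.
    have hnorm : ∀ s : Finset ℕ, ‖F (⋃ n, A n) x - ∑ n ∈ s, F (A n) x‖ ^ 2 =
        (μ x).real (⋃ n, A n) - ∑ n ∈ s, (μ x).real (A n) := by
      intro s
      have e1 : inner ℂ (F (⋃ n, A n) x) (∑ n ∈ s, F (A n) x) =
          ((∑ n ∈ s, (μ x).real (A n) : ℝ) : ℂ) := by
        rw [inner_sum, Complex.ofReal_sum]
        refine Finset.sum_congr rfl fun n _ => ?_
        rw [h₂ _ _ hU (hA n), Set.inter_eq_self_of_subset_right (Set.subset_iUnion A n)]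
      have e2 : inner ℂ (∑ n ∈ s, F (A n) x) (∑ n ∈ s, F (A n) x) =
          ((∑ n ∈ s, (μ x).real (A n) : ℝ) : ℂ) := by
        rw [sum_inner, Complex.ofReal_sum]
        refine Finset.sum_congr rfl fun n hn => ?_
        rw [inner_sum, Finset.sum_eq_single_of_mem n hn, h₂ _ _ (hA n) (hA n), Set.inter_self]
        intro m _ hmn
        rw [h₂ _ _ (hA n) (hA m), (hd hmn.symm).inter_eq]
        simp
      have e3 := h₂ _ _ hU hU x
      rw [Set.inter_self] at e3
      rw [@norm_sub_sq ℂ, ← inner_self_eq_norm_sq (𝕜 := ℂ), ← inner_self_eq_norm_sq (𝕜 := ℂ),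
        e1, e2, e3]
      simp
      ring
    have hsum : HasSum (fun n => (μ x).real (A n)) ((μ x).real (⋃ n, A n)) := by
      have := (μ x).toSignedMeasure.m_iUnion hA hd
      simpa only [Measure.toSignedMeasure_apply_measurable (hA _),
        Measure.toSignedMeasure_apply_measurable hU] using this
    have hlim : Tendsto (fun s : Finset ℕ => ‖F (⋃ n, A n) x - ∑ n ∈ s, F (A n) x‖ ^ 2) atTop
        (𝓝 0) := by
      simp only [hnorm]
      have h : Tendsto (fun s : Finset ℕ => ∑ n ∈ s, (μ x).real (A n)) atTop
        (𝓝 ((μ x).real (⋃ n, A n))) := hsum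
      simpa using h.const_sub ((μ x).real (⋃ n, A n))
    rw [HasSum, SummationFilter.unconditional_filter, tendsto_iff_norm_sub_tendsto_zero]
    have hsq := hlim.sqrt
    simp only [Real.sqrt_sq (norm_nonneg _), Real.sqrt_zero] at hsq
    simpa only [norm_sub_rev] using hsq

theorem exists_linearIsometry_extension {V L : Type*} [AddCommGroup V] [Module ℂ V]
    [NormedAddCommGroup L] [NormedSpace ℂ L] (f : V →ₗ[ℂ] E) (e : V →ₗ[ℂ] L)
    (he : DenseRange e) (hn : ∀ v, ‖e v‖ = ‖f v‖) : ∃ W : L →ₗᵢ[ℂ] E, ∀ v, W (e v) = f v := by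
  have h := LinearMap.extendOfNorm_eq (f := f) (e := e) he
    ⟨1, fun v => by rw [one_mul]; exact (hn v).ge⟩
  refine ⟨⟨(f.extendOfNorm e : L →L[ℂ] E), fun u => ?_⟩, h⟩
  refine he.induction_on (p := fun u => ‖f.extendOfNorm e u‖ = ‖u‖) u
    (isClosed_eq (by fun_prop) (by fun_prop)) fun v => ?_
  rw [h, hn]

theorem inner_starAlgHom_apply_left {Y : Type*} [TopologicalSpace Y]
    (Φ : C(Y, ℂ) →⋆ₐ[ℂ] (E →L[ℂ] E)) (g : C(Y, ℂ)) (x y : E) :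
    inner ℂ (Φ g x) y = inner ℂ x (Φ (star g) y) := by
  rw [map_star, ContinuousLinearMap.star_eq_adjoint, ContinuousLinearMap.adjoint_inner_right]

variable {X : Type*} [MetricSpace X] [CompactSpace X] [MeasurableSpace X] [BorelSpace X]

open scoped ComplexOrder in
-- Riesz–Markov–Kakutani for `f ↦ ⟨x, Φ f x⟩` on real functions. Positivity comes from writing `f =
-- h²` with `h = √f`, so that the value is `‖Φ h x‖²`.
theorem exists_scalarMeasure_of_starAlgHom (Φ : C(X, ℂ) →⋆ₐ[ℂ] (E →L[ℂ] E)) (x : E) :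
    ∃ μ : Measure X, IsFiniteMeasure μ ∧
      ∀ g : C(X, ℂ), ∫ t, (g t).re ∂μ = (inner ℂ x (Φ g x)).re := by
  have hself : ∀ f : C(X, ℝ), IsSelfAdjoint (Φ (f.realToRCLike ℂ)) := fun f => by
    rw [IsSelfAdjoint, ← map_star]
    congr 1
    ext t
    simp
  have hnn : ∀ f : C(X, ℝ), 0 ≤ f → 0 ≤ (inner ℂ x (Φ (f.realToRCLike ℂ) x)).re := by
    intro f hf
    set h : C(X, ℝ) := ⟨fun t => Real.sqrt (f t), by fun_prop⟩ with hh
    have e : f.realToRCLike ℂ = h.realToRCLike ℂ * h.realToRCLike ℂ := by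
      ext t
      simp only [ContinuousMap.realToRCLike_apply, ContinuousMap.mul_apply, hh,
        ContinuousMap.coe_mk]
      rw [← RCLike.ofReal_mul]
      exact congrArg _ (Real.mul_self_sqrt (hf t)).symm
    have hs := hself h
    rw [ContinuousLinearMap.isSelfAdjoint_iff_isSymmetric] at hs
    rw [e, map_mul]
    change 0 ≤ (inner ℂ x (Φ (h.realToRCLike ℂ) (Φ (h.realToRCLike ℂ) x))).re
    have h1 := hs x (Φ (h.realToRCLike ℂ) x)
    simp only [ContinuousLinearMap.coe_coe] at h1
    rw [← h1]
    exact inner_self_nonneg (𝕜 := ℂ)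
  have hadd : ∀ f g : C(X, ℝ), (f + g).realToRCLike ℂ = f.realToRCLike ℂ + g.realToRCLike ℂ :=
    fun f g => by ext t; simp
  have hsmul : ∀ (c : ℝ) (f : C(X, ℝ)), (c • f).realToRCLike ℂ = (c : ℂ) • f.realToRCLike ℂ :=
    fun c f => by ext t; simp
  let Λ : CompactlySupportedContinuousMap X ℝ →ₚ[ℝ] ℝ := PositiveLinearMap.mk₀
    { toFun := fun f => (inner ℂ x (Φ (f.toContinuousMap.realToRCLike ℂ) x)).re
      map_add' := fun f g => by
        have : (f + g).toContinuousMap = f.toContinuousMap + g.toContinuousMap := rfl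
        rw [this, hadd, map_add, add_apply, inner_add_right, Complex.add_re]
      map_smul' := fun c f => by
        have : (c • f).toContinuousMap = c • f.toContinuousMap := rfl
        rw [this, hsmul, map_smul, smul_apply, inner_smul_right, Complex.re_ofReal_mul]
        rfl }
    (fun f hf => hnn _ hf)
  refine ⟨RealRMK.rieszMeasure Λ, inferInstance, fun g => ?_⟩
  set u : C(X, ℝ) := ⟨fun t => (g t).re, by fun_prop⟩ with hu
  set v : C(X, ℝ) := ⟨fun t => (g t).im, by fun_prop⟩ with hv
  have hg : g = u.realToRCLike ℂ + I • v.realToRCLike ℂ := by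
    ext t
    simp [hu, hv, mul_comm I]
  have h1 := RealRMK.integral_rieszMeasure Λ ⟨u, HasCompactSupport.of_compactSpace _⟩
  have h2 : (inner ℂ x (Φ (v.realToRCLike ℂ) x)).im = 0 := by
    have hs := hself v
    rw [ContinuousLinearMap.isSelfAdjoint_iff_isSymmetric] at hs
    exact hs.im_inner_self_apply x
  calc ∫ t, (g t).re ∂(RealRMK.rieszMeasure Λ) = (inner ℂ x (Φ (u.realToRCLike ℂ) x)).re := h1
    _ = (inner ℂ x (Φ g x)).re := by
      rw [hg, map_add, map_smul, add_apply, smul_apply, inner_add_right, inner_smul_right]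
      simp [h2]

/-- The measure representing the positive functional `g ↦ ⟪x, Φ g x⟫`. -/
def functionalMeasure (Φ : C(X, ℂ) →⋆ₐ[ℂ] (E →L[ℂ] E)) (x : E) : Measure X :=
  (exists_scalarMeasure_of_starAlgHom Φ x).choose

variable (Φ : C(X, ℂ) →⋆ₐ[ℂ] (E →L[ℂ] E))

instance (x : E) : IsFiniteMeasure (functionalMeasure Φ x) :=
  (exists_scalarMeasure_of_starAlgHom Φ x).choose_spec.1

theorem integral_re_functionalMeasure (x : E) (g : C(X, ℂ)) :
    ∫ t, (g t).re ∂(functionalMeasure Φ x) = (inner ℂ x (Φ g x)).re :=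
  (exists_scalarMeasure_of_starAlgHom Φ x).choose_spec.2 g

/-- Because `⟨Φ g x, Φ f (Φ g x)⟩ = ⟨x, Φ (g* f g) x⟩`. With `f = 1` it makes `g ↦ Φ g x` isometric
for the norm of `L²(μ_x)`. -/
theorem integral_functionalMeasure_apply (x : E) (f g : C(X, ℂ)) :
    ∫ t, (f t).re ∂(functionalMeasure Φ (Φ g x)) =
      ∫ t, ‖g t‖ ^ 2 * (f t).re ∂(functionalMeasure Φ x) := by
  have h := integral_re_functionalMeasure Φ x (star g * f * g)
  rw [integral_re_functionalMeasure, inner_starAlgHom_apply_left]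
  rw [map_mul, map_mul] at h
  change _ = (inner ℂ x (Φ (star g) (Φ f (Φ g x)))).re at h
  rw [← h]
  congr 1
  ext t
  have : star (g t) * f t * g t = ((‖g t‖ ^ 2 : ℝ) : ℂ) * f t := by
    rw [mul_right_comm, RCLike.star_def, Complex.conj_mul']
    norm_cast
  simp only [ContinuousMap.mul_apply, ContinuousMap.star_apply, this, Complex.re_ofReal_mul]

theorem functionalMeasure_apply (x : E) (g : C(X, ℂ)) :
    functionalMeasure Φ (Φ g x) =
      (functionalMeasure Φ x).withDensity fun t => ENNReal.ofReal (‖g t‖ ^ 2) := by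
  have hg : Continuous fun t => ‖g t‖ ^ 2 := by fun_prop
  have hint : Integrable (fun t => ‖g t‖ ^ 2) (functionalMeasure Φ x) :=
    hg.integrable_of_hasCompactSupport (HasCompactSupport.of_compactSpace _)
  have : IsFiniteMeasure
      ((functionalMeasure Φ x).withDensity fun t => ENNReal.ofReal (‖g t‖ ^ 2)) :=
    isFiniteMeasure_withDensity_ofReal hint.2
  refine ext_of_forall_integral_eq_of_IsFiniteMeasure fun f => ?_
  have h := integral_functionalMeasure_apply Φ x (f.toContinuousMap.realToRCLike ℂ) g
  rw [integral_withDensity_eq_integral_toReal_smul (by fun_prop)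
    (.of_forall fun _ => ENNReal.ofReal_lt_top)]
  simpa using h

theorem integral_norm_sq_functionalMeasure (x : E) (g : C(X, ℂ)) :
    ∫ t, ‖g t‖ ^ 2 ∂(functionalMeasure Φ x) = ‖Φ g x‖ ^ 2 := by
  have h := integral_functionalMeasure_apply Φ x 1 g
  rw [integral_re_functionalMeasure, map_one] at h
  simp only [ContinuousMap.one_apply, Complex.one_re, mul_one] at h
  rw [← h, ← inner_self_eq_norm_sq (𝕜 := ℂ)]
  rfl

theorem norm_toLp_functionalMeasure (x : E) (g : C(X, ℂ)) :
    ‖ContinuousMap.toLp 2 (functionalMeasure Φ x) ℂ g‖ = ‖Φ g x‖ := by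
  rw [← sq_eq_sq₀ (norm_nonneg _) (norm_nonneg _), ← integral_norm_sq_functionalMeasure,
    ← inner_self_eq_norm_sq (𝕜 := ℂ), L2.inner_def]
  have : ∀ᵐ t ∂(functionalMeasure Φ x), inner ℂ
      (ContinuousMap.toLp 2 (functionalMeasure Φ x) ℂ g t)
      (ContinuousMap.toLp 2 (functionalMeasure Φ x) ℂ g t) = ((‖g t‖ ^ 2 : ℝ) : ℂ) := by
    filter_upwards [ContinuousMap.coeFn_toLp (functionalMeasure Φ x) (𝕜 := ℂ) (p := 2) g] with t ht
    rw [ht, inner_self_eq_norm_sq_to_K]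
    norm_cast
  rw [integral_congr_ae this]
  exact congrArg Complex.re integral_ofReal

theorem exists_cyclicMap (x : E) : ∃ W : Lp ℂ 2 (functionalMeasure Φ x) →ₗᵢ[ℂ] E,
    ∀ g, W (ContinuousMap.toLp 2 (functionalMeasure Φ x) ℂ g) = Φ g x :=
  exists_linearIsometry_extension
    { toFun := fun g => Φ g x
      map_add' := fun f g => by rw [map_add, add_apply]
      map_smul' := fun c g => by rw [map_smul, smul_apply]; rfl }
    (ContinuousMap.toLp 2 (functionalMeasure Φ x) ℂ).toLinearMap
    (ContinuousMap.toLp_denseRange ℂ (functionalMeasure Φ x) ℂ (p := 2) ENNReal.ofNat_ne_top)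
    (norm_toLp_functionalMeasure Φ x)

/-- The isometry `L²(μ_x) → E` extending `g ↦ Φ g x`. -/
def cyclicMap (x : E) : Lp ℂ 2 (functionalMeasure Φ x) →ₗᵢ[ℂ] E := (exists_cyclicMap Φ x).choose

theorem cyclicMap_toLp (x : E) (g : C(X, ℂ)) :
    cyclicMap Φ x (ContinuousMap.toLp 2 (functionalMeasure Φ x) ℂ g) = Φ g x :=
  (exists_cyclicMap Φ x).choose_spec g

theorem exists_norm_sub_toLp_le (x : E) (f : Lp ℂ 2 (functionalMeasure Φ x)) {ε : ℝ}
    (hε : 0 < ε) : ∃ g : C(X, ℂ),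
      ‖ContinuousMap.toLp 2 (functionalMeasure Φ x) ℂ g - f‖ < ε := by
  have hd := ContinuousMap.toLp_denseRange ℂ (functionalMeasure Φ x) ℂ
    (p := 2) ENNReal.ofNat_ne_top
  obtain ⟨g, hg⟩ := hd.exists_dist_lt f hε
  exact ⟨g, by rwa [dist_comm, dist_eq_norm] at hg⟩

/-- `Φ k` acts on the cyclic subspace of `x` as multiplication by `k`. -/
theorem starAlgHom_cyclicMap (x : E) (k : C(X, ℂ)) {f f' : Lp ℂ 2 (functionalMeasure Φ x)}
    (h : ∀ᵐ t ∂(functionalMeasure Φ x), f' t = k t * f t) :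
    Φ k (cyclicMap Φ x f) = cyclicMap Φ x f' := by
  rw [← sub_eq_zero, ← norm_le_zero_iff]
  refine le_of_forall_pos_le_add fun δ hδ => ?_
  set C := ‖Φ k‖ + ‖k‖ + 1 with hC
  have hCpos : 0 < C := by positivity
  obtain ⟨g, hg⟩ := exists_norm_sub_toLp_le Φ x f (div_pos hδ hCpos)
  set L : C(X, ℂ) →L[ℂ] Lp ℂ 2 (functionalMeasure Φ x) :=
    ContinuousMap.toLp 2 (functionalMeasure Φ x) ℂ
  have h1 : ‖L (k * g) - f'‖ ≤ ‖k‖ * ‖L g - f‖ := by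
    refine Lp.norm_le_mul_norm_of_ae_le_mul ?_
    filter_upwards [h, Lp.coeFn_sub (L (k * g)) f', Lp.coeFn_sub (L g) f,
      ContinuousMap.coeFn_toLp (functionalMeasure Φ x) (𝕜 := ℂ) (p := 2) g,
      ContinuousMap.coeFn_toLp (functionalMeasure Φ x) (𝕜 := ℂ) (p := 2) (k * g)]
      with t h1 h2 h3 h4 h5
    rw [h2, h3, Pi.sub_apply, Pi.sub_apply, h4, h5, h1, ContinuousMap.mul_apply, ← mul_sub,
      norm_mul]
    gcongr
    exact k.norm_coe_le_norm t
  have h2 : Φ k (cyclicMap Φ x f) - cyclicMap Φ x f' =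
      cyclicMap Φ x (L (k * g) - f') - Φ k (cyclicMap Φ x (L g - f)) := by
    rw [map_sub, map_sub, map_sub, cyclicMap_toLp, cyclicMap_toLp, map_mul]
    change _ = Φ k (Φ g x) - _ - (Φ k (Φ g x) - _)
    abel
  calc ‖Φ k (cyclicMap Φ x f) - cyclicMap Φ x f'‖
      ≤ ‖cyclicMap Φ x (L (k * g) - f')‖ + ‖Φ k (cyclicMap Φ x (L g - f))‖ := by
        rw [h2]; exact norm_sub_le _ _
    _ ≤ ‖k‖ * ‖L g - f‖ + ‖Φ k‖ * ‖L g - f‖ := by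
        refine add_le_add ?_ ?_
        · rwa [LinearIsometry.norm_map]
        · refine (ContinuousLinearMap.le_opNorm _ _).trans_eq ?_
          rw [LinearIsometry.norm_map]
    _ ≤ C * ‖L g - f‖ := by
        rw [hC]
        nlinarith [norm_nonneg (L g - f)]
    _ ≤ C * (δ / C) := by gcongr
    _ = 0 + δ := by field_simp; ring

/-- The vector `χ_A(Φ) x`. -/
def projectionVector {A : Set X} (hA : MeasurableSet A) (x : E) : E :=
  cyclicMap Φ x (indicatorConstLp 2 hA (measure_ne_top _ A) 1)

/-- `projectionVector` is built in a different space `L²(μ_x)` for every `x`, so its linearity in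
`x` is not evident. One `g` close to the indicator of `A` in `L²(ρ)` serves all `x` with `μ_x ≤ ρ`,
and linearity is inherited from `Φ g`. -/
theorem exists_norm_projectionVector_sub_le {A : Set X} (hA : MeasurableSet A) (ρ : Measure X)
    [IsFiniteMeasure ρ] {ε : ℝ} (hε : 0 < ε) : ∃ g : C(X, ℂ), ∀ x, functionalMeasure Φ x ≤ ρ →
      ‖projectionVector Φ hA x - Φ g x‖ ≤ ε := by
  obtain ⟨g, hg, -⟩ := (memLp_indicator_const 2 hA (1 : ℂ)
    (Or.inr (measure_ne_top ρ A))).exists_boundedContinuous_eLpNorm_sub_le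
      ENNReal.ofNat_ne_top (ε := ENNReal.ofReal ε) (by simpa using hε)
  refine ⟨g.toContinuousMap, fun x hx => ?_⟩
  rw [projectionVector, ← cyclicMap_toLp, ← map_sub, LinearIsometry.norm_map, Lp.norm_def]
  refine ENNReal.toReal_le_of_le_ofReal hε.le (le_trans ?_ hg)
  refine le_trans (le_of_eq (eLpNorm_congr_ae ?_)) (eLpNorm_mono_measure _ hx)
  filter_upwards [Lp.coeFn_sub (indicatorConstLp 2 hA (measure_ne_top _ A) (1 : ℂ))
      (ContinuousMap.toLp 2 (functionalMeasure Φ x) ℂ g.toContinuousMap),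
    ContinuousMap.coeFn_toLp (functionalMeasure Φ x) (𝕜 := ℂ) (p := 2) g.toContinuousMap,
    indicatorConstLp_coeFn (p := 2) (hs := hA)
      (hμs := measure_ne_top (functionalMeasure Φ x) A) (c := (1 : ℂ))] with t h1 h2 h3
  rw [h1, Pi.sub_apply, Pi.sub_apply, h2, h3]
  rfl

theorem projectionVector_add {A : Set X} (hA : MeasurableSet A) (x y : E) :
    projectionVector Φ hA (x + y) = projectionVector Φ hA x + projectionVector Φ hA y := by
  rw [← sub_eq_zero, ← norm_le_zero_iff]
  refine le_of_forall_pos_le_add fun δ hδ => ?_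
  obtain ⟨g, hg⟩ := exists_norm_projectionVector_sub_le Φ hA
    (functionalMeasure Φ x + functionalMeasure Φ y + functionalMeasure Φ (x + y))
    (show 0 < δ / 3 by positivity)
  have h1 := hg x ((Measure.le_add_right le_rfl).trans (Measure.le_add_right le_rfl))
  have h2 := hg y ((Measure.le_add_left le_rfl).trans (Measure.le_add_right le_rfl))
  have h3 := hg (x + y) (Measure.le_add_left le_rfl)
  have he : projectionVector Φ hA (x + y) - (projectionVector Φ hA x + projectionVector Φ hA y) =
      (projectionVector Φ hA (x + y) - Φ g (x + y)) - (projectionVector Φ hA x - Φ g x) -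
        (projectionVector Φ hA y - Φ g y) := by
    rw [map_add]; abel
  rw [he]
  refine (norm_sub_le _ _).trans ((add_le_add_left (norm_sub_le _ _) _).trans ?_)
  linarith

theorem projectionVector_smul {A : Set X} (hA : MeasurableSet A) (c : ℂ) (x : E) :
    projectionVector Φ hA (c • x) = c • projectionVector Φ hA x := by
  rw [← sub_eq_zero, ← norm_le_zero_iff]
  refine le_of_forall_pos_le_add fun δ hδ => ?_
  have hc : 0 < 1 + ‖c‖ := by positivity
  obtain ⟨g, hg⟩ := exists_norm_projectionVector_sub_le Φ hA
    (functionalMeasure Φ x + functionalMeasure Φ (c • x)) (div_pos hδ hc)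
  have h1 := hg x (Measure.le_add_right le_rfl)
  have h3 := hg (c • x) (Measure.le_add_left le_rfl)
  have he : projectionVector Φ hA (c • x) - c • projectionVector Φ hA x =
      (projectionVector Φ hA (c • x) - Φ g (c • x)) - c • (projectionVector Φ hA x - Φ g x) := by
    rw [map_smul, smul_sub]; abel
  rw [he]
  refine (norm_sub_le _ _).trans ?_
  rw [norm_smul]
  calc _ ≤ δ / (1 + ‖c‖) + ‖c‖ * (δ / (1 + ‖c‖)) := by gcongr
    _ = 0 + δ := by field_simp; ring

theorem inner_projectionVector {A B : Set X} (hA : MeasurableSet A) (hB : MeasurableSet B)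
    (x : E) : inner ℂ (projectionVector Φ hA x) (projectionVector Φ hB x) =
      ((functionalMeasure Φ x).real (A ∩ B) : ℂ) := by
  rw [projectionVector, projectionVector, LinearIsometry.inner_map_map,
    L2.inner_indicatorConstLp_indicatorConstLp]
  simp

theorem projectionVector_univ (x : E) : projectionVector Φ MeasurableSet.univ x = x := by
  have h : indicatorConstLp 2 MeasurableSet.univ (measure_ne_top (functionalMeasure Φ x) _) (1 : ℂ)
      = ContinuousMap.toLp 2 (functionalMeasure Φ x) ℂ (1 : C(X, ℂ)) := by
    apply Lp.ext
    filter_upwards [ContinuousMap.coeFn_toLp (functionalMeasure Φ x) (𝕜 := ℂ) (p := 2)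
        (1 : C(X, ℂ)),
      indicatorConstLp_coeFn (p := 2) (hs := MeasurableSet.univ)
        (hμs := measure_ne_top (functionalMeasure Φ x) _) (c := (1 : ℂ))] with t h1 h2
    rw [h1, h2]
    simp
  rw [projectionVector, h, cyclicMap_toLp, map_one]
  rfl

theorem functionalMeasure_real_univ (x : E) :
    (functionalMeasure Φ x).real Set.univ = ‖x‖ ^ 2 := by
  have h := inner_projectionVector Φ MeasurableSet.univ MeasurableSet.univ x
  rw [projectionVector_univ, Set.inter_self, inner_self_eq_ofReal] at h
  exact (Complex.ofReal_injective h).symm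

theorem norm_projectionVector_le {A : Set X} (hA : MeasurableSet A) (x : E) :
    ‖projectionVector Φ hA x‖ ≤ ‖x‖ := by
  have h := inner_projectionVector Φ hA hA x
  rw [Set.inter_self, inner_self_eq_ofReal] at h
  have h' : ‖projectionVector Φ hA x‖ ^ 2 = (functionalMeasure Φ x).real A :=
    Complex.ofReal_injective h
  rw [← sq_le_sq₀ (norm_nonneg _) (norm_nonneg _), h', ← functionalMeasure_real_univ Φ x]
  exact measureReal_mono (Set.subset_univ _)

theorem exists_projection {A : Set X} (hA : MeasurableSet A) :
    ∃ T : E →L[ℂ] E, ∀ x, T x = projectionVector Φ hA x :=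
  ⟨LinearMap.mkContinuous
    { toFun := projectionVector Φ hA
      map_add' := projectionVector_add Φ hA
      map_smul' := projectionVector_smul Φ hA } 1
    (fun x => by rw [one_mul]; exact norm_projectionVector_le Φ hA x), fun _ => rfl⟩

/-- For a Borel function `τ`, the push-forwards of the measures `μ_x` by `τ` are the scalar measures
of a projection-valued measure. -/
theorem exists_isProjectionValuedMeasure {τ : X → ℝ} (hτ : Measurable τ) :
    ∃ (F : Set ℝ → E →L[ℂ] E) (hF : IsProjectionValuedMeasure F),
      ∀ x, hF.scalarMeasure x = (functionalMeasure Φ x).map τ := by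
  classical
  let F : Set ℝ → E →L[ℂ] E := fun A =>
    if hA : MeasurableSet A then (exists_projection Φ (hτ hA)).choose else 0
  have hFA : ∀ A (hA : MeasurableSet A) x, F A x = projectionVector Φ (hτ hA) x := fun A hA x => by
    simp only [F, dif_pos hA]
    exact (exists_projection Φ (hτ hA)).choose_spec x
  have h₂ : ∀ A B, MeasurableSet A → MeasurableSet B → ∀ x, inner ℂ (F A x) (F B x) =
      (((functionalMeasure Φ x).map τ).real (A ∩ B) : ℂ) := fun A B hA hB x => by
    rw [hFA A hA, hFA B hB, inner_projectionVector, map_measureReal_apply hτ (hA.inter hB)]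
    rfl
  have hone : ∀ x, F Set.univ x = x := fun x => by
    rw [hFA _ MeasurableSet.univ]
    exact projectionVector_univ Φ x
  have hF : IsProjectionValuedMeasure F := by
    have (x : E) : IsFiniteMeasure ((functionalMeasure Φ x).map τ) := inferInstance
    refine IsProjectionValuedMeasure.of_measures (μ := fun x => (functionalMeasure Φ x).map τ)
      (fun A hA x => ?_) h₂ fun x => ?_
    · have := h₂ Set.univ A MeasurableSet.univ hA x
      rwa [hone, Set.univ_inter] at this
    · rw [map_measureReal_apply hτ MeasurableSet.univ, Set.preimage_univ,
        functionalMeasure_real_univ]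
  refine ⟨F, hF, fun x => Measure.ext fun A hA => ?_⟩
  have h := h₂ A A hA hA x
  rw [Set.inter_self, inner_self_eq_ofReal] at h
  have h' : ‖F A x‖ ^ 2 = ((functionalMeasure Φ x).map τ).real A := Complex.ofReal_injective h
  rw [hF.scalarMeasure_apply hA, h', ofReal_measureReal]

end Construction

/-! ### Resolvents of self-adjoint operators and the spectral theorem. -/

section SpectralTheorem

variable {E : Type*} [NormedAddCommGroup E] [InnerProductSpace ℂ E]

/-- A symmetric operator all of whose nonreal resolvents exist. -/
structure IsSymmetricWithResolvents (H : E →ₗ.[ℂ] E) : Prop where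
  isFormalAdjoint : H.IsFormalAdjoint H
  exists_resolvent : ∀ z : ℂ, z.im ≠ 0 → ∃ R, IsResolventAt H z R

theorem inner_sub_smul_self {H : E →ₗ.[ℂ] E} (hs : H.IsFormalAdjoint H) (x : H.domain) (z : ℂ) :
    (inner ℂ (H x - z • (x : E)) (x : E)).im = z.im * ‖(x : E)‖ ^ 2 := by
  have h1 : (inner ℂ (H x) (x : E)).im = 0 := by
    have h2 := hs x x
    rw [← inner_conj_symm (x : E)] at h2
    exact Complex.conj_eq_iff_im.1 h2.symm
  rw [inner_sub_left, inner_smul_left, inner_self_eq_ofReal, Complex.sub_im, h1,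
    Complex.im_mul_ofReal]
  simp

theorem im_mul_norm_le {H : E →ₗ.[ℂ] E} (hs : H.IsFormalAdjoint H) (x : H.domain) (z : ℂ) :
    |z.im| * ‖(x : E)‖ ≤ ‖H x - z • (x : E)‖ := by
  by_cases hx : ‖(x : E)‖ = 0
  · rw [hx, mul_zero]; exact norm_nonneg _
  have hpos : 0 < ‖(x : E)‖ := lt_of_le_of_ne (norm_nonneg _) (Ne.symm hx)
  have h := (Complex.abs_im_le_norm _).trans (norm_inner_le_norm (𝕜 := ℂ)
    (H x - z • (x : E)) (x : E))
  rw [inner_sub_smul_self hs, abs_mul, abs_of_nonneg (by positivity : 0 ≤ ‖(x : E)‖ ^ 2), sq,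
    ← mul_assoc] at h
  exact le_of_mul_le_mul_right h hpos

theorem IsResolventAt.eq_of_sub_smul {H : E →ₗ.[ℂ] E} {z : ℂ} {R : E →L[ℂ] E}
    (hR : IsResolventAt H z R) {y : E} (x : H.domain) (h : H x - z • (x : E) = y) : R y = x := by
  rw [← h]
  exact hR.2 x

theorem inner_resolvent_left {H : E →ₗ.[ℂ] E} (hs : H.IsFormalAdjoint H) {z : ℂ}
    {R R' : E →L[ℂ] E} (hR : IsResolventAt H z R) (hR' : IsResolventAt H (star z) R') (x y : E) :
    inner ℂ (R x) y = inner ℂ x (R' y) := by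
  obtain ⟨h1, e1⟩ := hR.1 x
  obtain ⟨h2, e2⟩ := hR'.1 y
  have h := hs ⟨R x, h1⟩ ⟨R' y, h2⟩
  simp only at h
  nth_rewrite 1 [← e2]
  nth_rewrite 2 [← e1]
  rw [inner_sub_right, inner_sub_left, inner_smul_left, inner_smul_right, h]
  rfl

variable [CompleteSpace E]

/-- The bound `|Im z| ‖x‖ ≤ ‖(H - z) x‖` makes `H - z` injective and, as `H` is closed, its range
closed. A vector orthogonal to the range is in the kernel of `H* - z̄ = H - z̄`, which is zero by
the same bound. -/
theorem isSymmetricWithResolvents_of_isSelfAdjoint {H : E →ₗ.[ℂ] E} (hH : IsSelfAdjoint H) :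
    IsSymmetricWithResolvents H := by
  have hd := hH.dense_domain
  have hadj : H.adjoint = H := hH
  have hs : H.IsFormalAdjoint H := by
    have := LinearPMap.adjoint_isFormalAdjoint (T := H) hd
    rwa [hadj] at this
  refine ⟨hs, fun z hz => ?_⟩
  have hz' : 0 < |z.im| := abs_pos.2 hz
  let L : H.domain →ₗ[ℂ] E := H.toFun - z • H.domain.subtype
  have hL : ∀ x : H.domain, L x = H x - z • (x : E) := fun x => rfl
  have hcl : IsClosed (LinearMap.range L : Set E) := by
    rw [← isSeqClosed_iff_isClosed]
    intro u y hu hy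
    choose x hx using hu
    have hcau : CauchySeq fun n => ((x n : H.domain) : E) := by
      have hu' := hy.cauchySeq
      rw [Metric.cauchySeq_iff] at hu' ⊢
      intro ε hε
      obtain ⟨N, hN⟩ := hu' (|z.im| * ε) (by positivity)
      refine ⟨N, fun m hm n hn => ?_⟩
      have h1 := hN m hm n hn
      rw [dist_eq_norm] at h1 ⊢
      have h2 := im_mul_norm_le hs (x m - x n) z
      rw [← hL, map_sub, hx, hx] at h2
      exact lt_of_mul_lt_mul_left (h2.trans_lt h1) hz'.le
    obtain ⟨x₀, hx₀⟩ := cauchySeq_tendsto_of_complete hcau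
    have hHx : Filter.Tendsto (fun n => H (x n)) Filter.atTop (nhds (y + z • x₀)) := by
      refine (hy.add (hx₀.const_smul z)).congr fun n => ?_
      rw [← hx n, hL]
      abel
    have hmem : ((x₀, y + z • x₀) : E × E) ∈ H.graph := by
      have hclosed : IsClosed (H.graph : Set (E × E)) := hH.isClosed
      refine hclosed.mem_of_tendsto (hx₀.prodMk_nhds hHx) (.of_forall fun n => ?_)
      exact H.mem_graph (x n)
    obtain ⟨w, hw1, hw2⟩ := (LinearPMap.mem_graph_iff H).1 hmem
    refine ⟨w, ?_⟩
    rw [hL, hw2, hw1]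
    simp
  have hort : (LinearMap.range L)ᗮ = ⊥ := by
    rw [Submodule.eq_bot_iff]
    intro y hy
    have hy' : ∀ x : H.domain, inner ℂ (star z • y) (x : E) = inner ℂ y (H x) := by
      intro x
      have := (Submodule.mem_orthogonal' _ _).1 hy (L x) ⟨x, rfl⟩
      rw [hL, inner_sub_right, inner_smul_right, sub_eq_zero] at this
      rw [this, inner_smul_left]
      simp
    have hmem := LinearPMap.mem_adjoint_domain_of_exists (T := H) y ⟨_, hy'⟩
    have hval := LinearPMap.adjoint_apply_eq hd ⟨y, hmem⟩ hy'
    rw [hadj] at hmem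
    have hval' : H ⟨y, hmem⟩ = star z • y := by
      rw [← hval]
      exact Eq.symm (@(LinearPMap.ext_iff.1 hadj).2 y _ hmem)
    have h3 := im_mul_norm_le hs ⟨y, hmem⟩ (star z)
    rw [hval'] at h3
    simp only [sub_self, norm_zero] at h3
    have : |(star z).im| = |z.im| := by simp
    rw [this] at h3
    have : ‖y‖ ≤ 0 := by
      by_contra hc
      push Not at hc
      nlinarith [mul_pos hz' hc]
    exact norm_le_zero_iff.1 this
  have hsurj : Function.Surjective L := by
    rw [← LinearMap.range_eq_top]
    have : CompleteSpace (LinearMap.range L) := hcl.completeSpace_coe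
    exact Submodule.orthogonal_eq_bot_iff.1 hort
  have hinj : Function.Injective L := by
    rw [← LinearMap.ker_eq_bot, LinearMap.ker_eq_bot']
    intro x hx
    have h := im_mul_norm_le hs x z
    rw [← hL, hx, norm_zero] at h
    have : ‖(x : E)‖ ≤ 0 := by
      by_contra hc
      push Not at hc
      nlinarith [mul_pos hz' hc]
    exact Subtype.ext (norm_le_zero_iff.1 this)
  let e := LinearEquiv.ofBijective L ⟨hinj, hsurj⟩
  let R : E →L[ℂ] E := LinearMap.mkContinuous (H.domain.subtype ∘ₗ e.symm.toLinearMap) (|z.im|⁻¹)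
    (fun y => by
      have h := im_mul_norm_le hs (e.symm y) z
      rw [← hL, show L (e.symm y) = y from e.apply_symm_apply y] at h
      rw [inv_mul_eq_div, le_div_iff₀' hz']
      exact h)
  refine ⟨R, fun y => ⟨(e.symm y).2, ?_⟩, fun x => ?_⟩
  · exact e.apply_symm_apply y
  · change ((e.symm (L x) : H.domain) : E) = x
    rw [show e.symm (L x) = x from e.symm_apply_apply x]

/-- The resolvent identity between `i` and `-i`, written in both orders, shows that `R` and `R' =
R*` commute. -/
theorem isStarNormal_resolvent {H : E →ₗ.[ℂ] E} (hs : H.IsFormalAdjoint H) {R R' : E →L[ℂ] E}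
    (hR : IsResolventAt H I R) (hR' : IsResolventAt H (-I) R') :
    star R = R' ∧ R - R' = (2 * I) • (R' * R) ∧ IsStarNormal R := by
  have hstar : star R = R' := by
    rw [ContinuousLinearMap.star_eq_adjoint]
    symm
    rw [ContinuousLinearMap.eq_adjoint_iff]
    intro x y
    rw [← inner_conj_symm, ← inner_resolvent_left hs hR (by simpa using hR'), inner_conj_symm]
  have hd : ∀ x, R x - R' x = (2 * I) • R' (R x) := by
    intro x
    obtain ⟨h1, e1⟩ := hR.1 x
    have h2 : H ⟨R x, h1⟩ - (-I) • (R x) = x + (2 * I) • R x := by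
      rw [sub_eq_iff_eq_add.1 e1, two_mul, add_smul, neg_smul]; abel
    have h3 := hR'.eq_of_sub_smul ⟨R x, h1⟩ h2
    rw [map_add, map_smul] at h3
    simp only at h3
    rw [sub_eq_iff_eq_add']
    exact h3.symm
  have hd' : ∀ x, R x - R' x = (2 * I) • R (R' x) := by
    intro x
    obtain ⟨h1, e1⟩ := hR'.1 x
    have h2 : H ⟨R' x, h1⟩ - I • (R' x) = x - (2 * I) • R' x := by
      rw [sub_eq_iff_eq_add.1 e1, two_mul, add_smul, neg_smul]; abel
    have h3 := hR.eq_of_sub_smul ⟨R' x, h1⟩ h2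
    rw [map_sub, map_smul] at h3
    simp only at h3
    rw [sub_eq_iff_eq_add'] at h3 ⊢
    rw [h3]; abel
  refine ⟨hstar, ContinuousLinearMap.ext hd, ⟨?_⟩⟩
  rw [hstar, Commute, SemiconjBy]
  ext x
  have h := (hd x).symm.trans (hd' x)
  exact smul_right_injective E (by simp : (2 * I) ≠ 0) h

end SpectralTheorem

section SpectralTheorem

variable {E : Type*} [NormedAddCommGroup E] [InnerProductSpace ℂ E] [CompleteSpace E]

/-- The **spectral theorem**: a self-adjoint operator has a spectral measure. -/
theorem IsSymmetricWithResolvents.exists_isSpectralMeasureOf {H : E →ₗ.[ℂ] E}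
    (hH : IsSymmetricWithResolvents H) : ∃ F, IsSpectralMeasureOf H F := by
  have hs := hH.isFormalAdjoint
  obtain ⟨R, hR⟩ := hH.exists_resolvent I (by simp)
  obtain ⟨R', hR'⟩ := hH.exists_resolvent (-I) (by simp)
  obtain ⟨hstar, hdiff, hnormal⟩ := isStarNormal_resolvent hs hR hR'
  let X := spectrum ℂ R
  have : CompactSpace X := isCompact_iff_compactSpace.1 (spectrum.isCompact R)
  let Φ : C(X, ℂ) →⋆ₐ[ℂ] (E →L[ℂ] E) := cfcHom hnormal
  let ζ : C(X, ℂ) := ContinuousMap.restrict X (ContinuousMap.id ℂ)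
  have hζ : ∀ w : X, ζ w = (w : ℂ) := fun _ => rfl
  have hΦζ : Φ ζ = R := cfcHom_id hnormal
  -- The identity `R - R* = 2i R* R` read on the spectrum of `R`: it lies on the image of the real
  -- line under `t ↦ (t - i)⁻¹`, completed by `0`.
  have hcircle : ∀ w : X, (w : ℂ).im = ‖(w : ℂ)‖ ^ 2 := by
    have h0 : ζ - star ζ = (2 * I) • (star ζ * ζ) := by
      apply cfcHom_injective hnormal
      change Φ _ = Φ _
      rw [map_sub, map_smul, map_mul, map_star, hΦζ, hstar, hdiff]
    intro w
    have h1 := congrArg (fun g : C(X, ℂ) => (g w).im) h0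
    simp only [ContinuousMap.sub_apply, ContinuousMap.smul_apply, ContinuousMap.mul_apply,
      ContinuousMap.star_apply, hζ, RCLike.star_def, Complex.conj_mul', smul_eq_mul] at h1
    have h2 : (2 * I * (‖(w : ℂ)‖ : ℂ) ^ 2).im = 2 * ‖(w : ℂ)‖ ^ 2 := by
      rw [← Complex.ofReal_pow, Complex.im_mul_ofReal]
      simp
    rw [h2, Complex.sub_im, Complex.conj_im] at h1
    linarith
  have hRinj : ∀ y, R y = 0 → y = 0 := by
    intro y hy
    obtain ⟨h, e⟩ := hR.1 y
    have h0 : (⟨R y, h⟩ : H.domain) = 0 := Subtype.ext hy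
    rw [h0, H.map_zero, hy] at e
    simpa using e.symm
  -- The point `0` corresponds to `t = ∞`. It carries no mass because `R` is injective and
  -- annihilates the spectral subspace of `0`.
  have hnull : ∀ x, functionalMeasure Φ x {w : X | (w : ℂ) = 0} = 0 := by
    intro x
    have hN : MeasurableSet {w : X | (w : ℂ) = 0} :=
      measurable_subtype_coe (measurableSet_singleton 0)
    have h1 := starAlgHom_cyclicMap Φ x ζ
      (f := indicatorConstLp 2 hN (measure_ne_top _ _) 1) (f' := 0) (by
        filter_upwards [Lp.coeFn_zero ℂ 2 (functionalMeasure Φ x),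
          indicatorConstLp_coeFn (p := 2) (hs := hN)
            (hμs := measure_ne_top (functionalMeasure Φ x) _) (c := (1 : ℂ))] with w hw1 hw2
        rw [hw1, hw2, hζ]
        by_cases hw : (w : ℂ) = 0 <;> simp [hw])
    rw [map_zero, hΦζ] at h1
    have h2 : projectionVector Φ hN x = 0 := hRinj _ h1
    have h3 := inner_projectionVector Φ hN hN x
    rw [h2, inner_zero_left, Set.inter_self] at h3
    have h4 : (functionalMeasure Φ x).real {w : X | (w : ℂ) = 0} = 0 :=
      (Complex.ofReal_injective h3).symm
    exact (measureReal_eq_zero_iff).1 h4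
  -- Inverse of `w = (t - i)⁻¹`, namely `t = Re w⁻¹`, as `Im w⁻¹ = -1`. The value `τ = 0` at `w = 0`
  -- is harmless by `hnull`.
  let τ : X → ℝ := fun w => ((w : ℂ)⁻¹).re
  have hτ : Measurable τ := Complex.measurable_re.comp measurable_subtype_coe.inv
  have hτsq : ∀ w : X, (w : ℂ) ≠ 0 → τ w ^ 2 + 1 = ‖(w : ℂ)⁻¹‖ ^ 2 := by
    intro w hw
    have hn : Complex.normSq (w : ℂ) ≠ 0 := by simpa using hw
    have h1 : ((w : ℂ)⁻¹).im = -1 := by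
      rw [Complex.inv_im, hcircle, ← Complex.normSq_eq_norm_sq]
      field_simp
    rw [← Complex.normSq_eq_norm_sq, Complex.normSq_apply, h1]
    simp only [τ]
    ring
  have hτmul : ∀ w : X, ‖(w : ℂ)‖ ^ 2 * τ w = (w : ℂ).re := by
    intro w
    by_cases hw : (w : ℂ) = 0
    · simp [hw]
    have hn : Complex.normSq (w : ℂ) ≠ 0 := by simpa using hw
    simp only [τ]
    rw [Complex.inv_re, ← Complex.normSq_eq_norm_sq]
    field_simp
  obtain ⟨F, hF, hFm⟩ := exists_isProjectionValuedMeasure Φ hτ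
  refine ⟨F, hF, fun x => ?_, fun x => ?_⟩
  · rw [hFm, lintegral_map (by fun_prop) hτ]
    constructor
    · intro hx
      -- For `x = R y` one has `μ_x = |w|² μ_y`, and `|w|² τ² ≤ 1`.
      have hxy : Φ ζ (H ⟨x, hx⟩ - I • x) = x := by rw [hΦζ]; exact hR.2 ⟨x, hx⟩
      rw [← hxy, functionalMeasure_apply,
        lintegral_withDensity_eq_lintegral_mul _ (by fun_prop) (by fun_prop)]
      refine (lintegral_mono (g := fun _ => 1) fun w => ?_).trans_lt
        (by rw [lintegral_one]; exact measure_lt_top (functionalMeasure Φ _) _)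
      rw [Pi.mul_apply, ← ENNReal.ofReal_mul (by positivity), hζ, ← ENNReal.ofReal_one]
      refine ENNReal.ofReal_le_ofReal ?_
      by_cases hw : (w : ℂ) = 0
      · simp [hw]
      · have h1 := hτsq w hw
        have h2 : ‖(w : ℂ)‖ ^ 2 * ‖(w : ℂ)⁻¹‖ ^ 2 = 1 := by
          rw [← mul_pow, ← norm_mul, mul_inv_cancel₀ hw]; simp
        nlinarith [sq_nonneg ‖(w : ℂ)‖]
    · intro hx
      have hne : ∀ᵐ w : X ∂(functionalMeasure Φ x), (w : ℂ) ≠ 0 :=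
        measure_eq_zero_iff_ae_notMem.1 (hnull x)
      have hm : Measurable fun w : X => (w : ℂ)⁻¹ := measurable_subtype_coe.inv
      have hmem : MemLp (fun w : X => (w : ℂ)⁻¹) 2 (functionalMeasure Φ x) := by
        rw [memLp_two_iff_integrable_sq_norm hm.aestronglyMeasurable]
        have h1 : Integrable (fun w : X => τ w ^ 2 + 1) (functionalMeasure Φ x) := by
          refine Integrable.add ⟨(hτ.pow_const 2).aestronglyMeasurable, ?_⟩ (integrable_const _)
          rw [hasFiniteIntegral_iff_ofReal (.of_forall fun t => by positivity)]
          exact hx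
        refine h1.congr ?_
        filter_upwards [hne] with w hw using hτsq w hw
      -- Conversely `w⁻¹` lies in `L²(μ_x)`, and `R` maps the vector it represents to `x`, so `x` is
      -- in the range of `R`.
      have h1 := starAlgHom_cyclicMap Φ x ζ (f := hmem.toLp _)
        (f' := indicatorConstLp 2 MeasurableSet.univ (measure_ne_top _ _) 1) (by
          filter_upwards [hne, hmem.coeFn_toLp,
            indicatorConstLp_coeFn (p := 2) (hs := MeasurableSet.univ)
              (hμs := measure_ne_top (functionalMeasure Φ x) _) (c := (1 : ℂ))] with w hw hw1 hw2
          rw [hw1, hw2, hζ, mul_inv_cancel₀ hw]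
          simp)
      rw [hΦζ] at h1
      have h2 : R (cyclicMap Φ x (hmem.toLp _)) = x := h1.trans (projectionVector_univ Φ x)
      rw [← h2]
      exact (hR.1 _).1
  -- With `x = R y`, both sides equal `Re ⟨y, R y⟩`, the integral of `Re w = |w|² τ` against `μ_y`.
  · set y := H x - I • (x : E) with hy
    have hxy : Φ ζ y = x := by rw [hΦζ]; exact hR.2 x
    have hreal : (inner ℂ (x : E) (H x)).im = 0 := by
      have h := hs x x
      rw [← inner_conj_symm] at h
      exact Complex.conj_eq_iff_im.1 h
    have hre : (inner ℂ (x : E) (H x)).re = (inner ℂ y (Φ ζ y)).re := by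
      rw [hxy, hy, inner_sub_left, inner_smul_left, inner_self_eq_ofReal, Complex.sub_re,
        Complex.re_mul_ofReal, ← inner_conj_symm (H x), Complex.conj_re]
      simp
    have hint : ∫ t, t ∂(hF.scalarMeasure (x : E)) = (inner ℂ y (Φ ζ y)).re := by
      rw [hFm, integral_map hτ.aemeasurable (by fun_prop), ← hxy, functionalMeasure_apply,
        integral_withDensity_eq_integral_toReal_smul (by fun_prop)
          (.of_forall fun _ => ENNReal.ofReal_lt_top), hxy, ← hxy, ← integral_re_functionalMeasure]
      refine integral_congr_ae (.of_forall fun w => ?_)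
      simp only
      rw [ENNReal.toReal_ofReal (by positivity), hζ, smul_eq_mul, hτmul]
    rw [hint, ← hre]
    exact Complex.ext (by simp) (by simpa using hreal)

end SpectralTheorem

/-! ### The spectrum as support of the scalar measures; reducing subspaces. -/

section SpectrumAndSupport

variable {E : Type*} [NormedAddCommGroup E] [InnerProductSpace ℂ E] [CompleteSpace E]

/-- Neumann series, from the factorization `H - z' = (1 - (z' - z) R) (H - z)`. -/
theorem IsResolventAt.exists_of_norm_lt {H : E →ₗ.[ℂ] E} {z z' : ℂ} {R : E →L[ℂ] E}
    (hR : IsResolventAt H z R) (h : ‖(z' - z) • R‖ < 1) : ∃ R', IsResolventAt H z' R' := by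
  set u := Units.oneSub ((z' - z) • R) h
  have hu : ∀ y, (u : E →L[ℂ] E) y = y - (z' - z) • R y := fun y => rfl
  have h1 : ∀ y, (u : E →L[ℂ] E) ((↑u⁻¹ : E →L[ℂ] E) y) = y := fun y => by
    have := congrArg (fun T : E →L[ℂ] E => T y) u.mul_inv
    exact this
  have h2 : ∀ y, (↑u⁻¹ : E →L[ℂ] E) ((u : E →L[ℂ] E) y) = y := fun y => by
    have := congrArg (fun T : E →L[ℂ] E => T y) u.inv_mul
    exact this
  refine ⟨R * (↑u⁻¹ : E →L[ℂ] E), fun y => ?_, fun x => ?_⟩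
  · obtain ⟨hd, e⟩ := hR.1 ((↑u⁻¹ : E →L[ℂ] E) y)
    refine ⟨hd, ?_⟩
    have h3 := h1 y
    rw [hu] at h3
    rw [sub_eq_iff_eq_add] at e
    change H ⟨R ((↑u⁻¹ : E →L[ℂ] E) y), hd⟩ - z' • R ((↑u⁻¹ : E →L[ℂ] E) y) = y
    rw [e]
    nth_rewrite 4 [← h3]
    rw [sub_smul]
    abel
  · have e := hR.2 x
    have h3 : H x - z' • (x : E) = (u : E →L[ℂ] E) (H x - z • (x : E)) := by
      rw [hu, e, sub_smul]
      abel
    change R ((↑u⁻¹ : E →L[ℂ] E) (H x - z' • (x : E))) = x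
    rw [h3, h2, e]

/-- A vector `y` in the spectral subspace of the ball satisfies `‖(H - s) y‖ ≤ δ ‖y‖`, hence `‖y‖ ≤
‖R‖ δ ‖y‖`. The choice of `δ` makes `‖R‖ δ < 1`, so `y = 0`. -/
theorem IsSpectralMeasureOf.exists_ball_null_of_resolvent {H : E →ₗ.[ℂ] E}
    {F : Set ℝ → E →L[ℂ] E} (h : IsSpectralMeasureOf H F) (hs : H.IsFormalAdjoint H) {s : ℝ}
    {R : E →L[ℂ] E} (hR : IsResolventAt H s R) :
    ∃ δ > 0, ∀ x, h.pvm.scalarMeasure x (Metric.ball s δ) = 0 := by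
  set δ := (‖R‖ + 1)⁻¹ with hδ
  have hδpos : 0 < δ := by positivity
  refine ⟨δ, hδpos, fun x => ?_⟩
  have hB : MeasurableSet (Metric.ball s δ) := measurableSet_ball
  have hC : ∀ t ∈ Metric.ball s δ, |t| ≤ |s| + δ := fun t ht => by
    rw [Metric.mem_ball, Real.dist_eq] at ht
    have := abs_sub_abs_le_abs_sub t s
    linarith
  have hd := h.projection_mem_domain_of_bounded hB hC x
  set y : H.domain := ⟨F (Metric.ball s δ) x, hd⟩ with hy
  have h1 : ‖H y - (s : ℂ) • (y : E)‖ ≤ δ * ‖(y : E)‖ := by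
    rw [← sq_le_sq₀ (norm_nonneg _) (by positivity), mul_pow,
      ← ENNReal.ofReal_le_ofReal_iff (by positivity), h.ofReal_norm_sub_smul_sq hs,
      ENNReal.ofReal_mul (by positivity), ← h.pvm.scalarMeasure_univ, ← lintegral_const]
    refine lintegral_mono_ae ?_
    have : h.pvm.scalarMeasure (y : E) = (h.pvm.scalarMeasure x).restrict (Metric.ball s δ) :=
      h.pvm.scalarMeasure_projection hB x
    rw [this]
    filter_upwards [ae_restrict_mem hB] with t ht
    refine ENNReal.ofReal_le_ofReal ?_
    rw [Metric.mem_ball, Real.dist_eq] at ht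
    rw [← Complex.ofReal_sub, Complex.norm_real, Real.norm_eq_abs]
    gcongr
  have h2 : ‖(y : E)‖ ≤ ‖R‖ * (δ * ‖(y : E)‖) := by
    calc ‖(y : E)‖ = ‖R (H y - (s : ℂ) • (y : E))‖ := by rw [hR.2 y]
      _ ≤ ‖R‖ * ‖H y - (s : ℂ) • (y : E)‖ := R.le_opNorm _
      _ ≤ _ := by gcongr
  have h3 : ‖R‖ * δ < 1 := by
    rw [hδ, ← div_eq_mul_inv, div_lt_one (by positivity)]
    linarith
  have h4 : ‖(y : E)‖ = 0 := by
    by_contra hne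
    have : 0 < ‖(y : E)‖ := lt_of_le_of_ne (norm_nonneg _) (Ne.symm hne)
    nlinarith
  rw [h.pvm.scalarMeasure_apply hB]
  change ENNReal.ofReal (‖(y : E)‖ ^ 2) = 0
  rw [h4]
  simp

/-- At the nonreal point `s + iδ/2` the resolvent has norm at most `δ⁻¹`, since `|t - s| ≥ δ` almost
everywhere. The point `s` is at distance `δ/2`, within reach of the Neumann series. -/
theorem IsSpectralMeasureOf.exists_resolvent_of_ball_null {H : E →ₗ.[ℂ] E}
    {F : Set ℝ → E →L[ℂ] E} (h : IsSpectralMeasureOf H F) (hH : IsSymmetricWithResolvents H)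
    {s δ : ℝ} (hδ : 0 < δ) (hnull : ∀ x, h.pvm.scalarMeasure x (Metric.ball s δ) = 0) :
    ∃ R, IsResolventAt H s R := by
  have hz : ((s : ℂ) + (δ / 2 : ℝ) * I).im ≠ 0 := by simpa using hδ.ne'
  obtain ⟨R, hR⟩ := hH.exists_resolvent ((s : ℂ) + (δ / 2 : ℝ) * I) hz
  have hn : ‖R‖ ≤ δ⁻¹ := by
    refine R.opNorm_le_bound (by positivity) fun x => ?_
    rw [← sq_le_sq₀ (norm_nonneg _) (by positivity), mul_pow,
      ← ENNReal.ofReal_le_ofReal_iff (by positivity),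
      ← h.lintegral_inv_norm_sub_sq hH.isFormalAdjoint hz hR,
      ENNReal.ofReal_mul (by positivity), ← h.pvm.scalarMeasure_univ, ← lintegral_const]
    refine lintegral_mono_ae ?_
    filter_upwards [measure_eq_zero_iff_ae_notMem.1 (hnull x)] with t ht
    refine ENNReal.ofReal_le_ofReal ?_
    rw [Metric.mem_ball, Real.dist_eq, not_lt] at ht
    rw [norm_ofReal_sub_sq, inv_pow]
    refine inv_anti₀ (by positivity) ?_
    have : δ ^ 2 ≤ (t - s) ^ 2 := by
      rw [← sq_abs (t - s)]
      gcongr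
    nlinarith [sq_nonneg (δ / 2)]
  refine hR.exists_of_norm_lt ?_
  rw [norm_smul]
  have : ‖(s : ℂ) - (s + (δ / 2 : ℝ) * I)‖ = δ / 2 := by
    rw [sub_add_cancel_left, norm_neg, norm_mul, Complex.norm_I, mul_one, Complex.norm_real,
      Real.norm_of_nonneg (by positivity)]
  rw [this]
  calc δ / 2 * ‖R‖ ≤ δ / 2 * δ⁻¹ := by gcongr
    _ < 1 := by field_simp; norm_num

theorem IsSpectralMeasureOf.ofReal_notMem_opSpectrum_iff {H : E →ₗ.[ℂ] E}
    {F : Set ℝ → E →L[ℂ] E} (h : IsSpectralMeasureOf H F) (hH : IsSymmetricWithResolvents H)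
    {s : ℝ} : (s : ℂ) ∉ opSpectrum H ↔
      ∃ δ > 0, ∀ x, h.pvm.scalarMeasure x (Metric.ball s δ) = 0 := by
  rw [opSpectrum, Set.mem_ofPred_eq, not_not]
  exact ⟨fun ⟨R, hR⟩ => h.exists_ball_null_of_resolvent hH.isFormalAdjoint hR,
    fun ⟨δ, hδ, hn⟩ => h.exists_resolvent_of_ball_null hH hδ hn⟩

theorem IsSpectralMeasureOf.poissonIntegral_scalarMeasure {H : E →ₗ.[ℂ] E}
    {F : Set ℝ → E →L[ℂ] E} (h : IsSpectralMeasureOf H F) (hs : H.IsFormalAdjoint H)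
    {ε s : ℝ} (hε : 0 < ε) {R : E →L[ℂ] E} (hR : IsResolventAt H (s + ε * I) R) (x : E) :
    poissonIntegral (h.pvm.scalarMeasure x) ε s =
      ENNReal.ofReal (ε / Real.pi) * ENNReal.ofReal (‖R x‖ ^ 2) := by
  rw [poissonIntegral, h.lintegral_inv_norm_sub_sq hs (by simpa using hε.ne') hR]

/-- With `P` the projection onto `M`, the vector `w = R x - P R x` is orthogonal to `M` while `(H -
z) w` lies in `M`. Thus `⟨(H - z) w, w⟩ = 0`, and its imaginary part is `Im z ‖w‖²`. -/
theorem resolvent_mem_of_reduces {H : E →ₗ.[ℂ] E} (hs : H.IsFormalAdjoint H)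
    {M : ClosedSubmodule ℂ E} (hM : Reduces M H) {z : ℂ} (hz : z.im ≠ 0) {R : E →L[ℂ] E}
    (hR : IsResolventAt H z R) {x : E} (hx : x ∈ M.toSubmodule) : R x ∈ M.toSubmodule := by
  obtain ⟨hd, e⟩ := hR.1 x
  obtain ⟨hPd, hPM⟩ := hM (R x) hd
  have hmem := M.toSubmodule.starProjection_apply_mem (R x)
  set w : H.domain := ⟨R x, hd⟩ - ⟨_, hPd⟩ with hw
  have hwv : (w : E) = R x - M.toSubmodule.starProjection (R x) := rfl
  have h1 : H w - z • (w : E) ∈ M.toSubmodule := by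
    have : H w - z • (w : E) = x - (H ⟨_, hPd⟩ - z • M.toSubmodule.starProjection (R x)) := by
      rw [hwv, hw, H.map_sub, sub_eq_iff_eq_add.1 e, smul_sub]
      abel
    rw [this]
    exact sub_mem hx (sub_mem hPM (Submodule.smul_mem _ _ hmem))
  have h2 : (w : E) ∈ M.toSubmoduleᗮ := by
    rw [hwv]
    exact Submodule.sub_starProjection_mem_orthogonal _
  have h3 := inner_sub_smul_self hs w z
  rw [(Submodule.mem_orthogonal _ _).1 h2 _ h1] at h3
  have h4 : ‖(w : E)‖ = 0 := by simpa [hz] using h3.symm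
  have h5 : R x = M.toSubmodule.starProjection (R x) := by
    rw [← sub_eq_zero, ← hwv]
    exact norm_eq_zero.1 h4
  rw [h5]
  exact hmem

theorem IsSymmetricWithResolvents.exists_resolvent_restrictTo {H : E →ₗ.[ℂ] E}
    (hs : H.IsFormalAdjoint H) {M : ClosedSubmodule ℂ E} (hM : Reduces M H) {z : ℂ}
    (hz : z.im ≠ 0) {R : E →L[ℂ] E} (hR : IsResolventAt H z R) :
    ∃ R', IsResolventAt (restrictTo H M hM) z R' ∧ ∀ x, ((R' x : M.toSubmodule) : E) = R x := by
  have hm : ∀ x : M.toSubmodule, R x ∈ M.toSubmodule :=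
    fun x => resolvent_mem_of_reduces hs hM hz hR x.2
  refine ⟨(R.comp M.toSubmodule.subtypeL).codRestrict M.toSubmodule hm,
    ⟨fun y => ?_, fun x => ?_⟩, fun _ => rfl⟩
  · obtain ⟨hd, e⟩ := hR.1 y
    exact ⟨hd, Subtype.ext e⟩
  · exact Subtype.ext (hR.2 ⟨((x : M.toSubmodule) : E), x.2⟩)

theorem IsSymmetricWithResolvents.restrictTo {H : E →ₗ.[ℂ] E} (hH : IsSymmetricWithResolvents H)
    {M : ClosedSubmodule ℂ E} (hM : Reduces M H) :
    IsSymmetricWithResolvents (restrictTo H M hM) where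
  isFormalAdjoint x y := hH.isFormalAdjoint ⟨((x : M.toSubmodule) : E), x.2⟩
    ⟨((y : M.toSubmodule) : E), y.2⟩
  exists_resolvent z hz := by
    obtain ⟨R, hR⟩ := hH.exists_resolvent z hz
    obtain ⟨R', hR', -⟩ := exists_resolvent_restrictTo hH.isFormalAdjoint hM hz hR
    exact ⟨R', hR'⟩

/-- If the spectral projection of `H` onto `J ∩ S` vanishes, where `S` is the spectrum of a reduced
part of `H`, then `S` does not meet the interior of `J`. The set `S` is closed. -/
theorem IsSymmetricWithResolvents.isClosed_and_interior_inter_eq_empty {H : E →ₗ.[ℂ] E}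
    (hH : IsSymmetricWithResolvents H) {F : Set ℝ → E →L[ℂ] E} (h : IsSpectralMeasureOf H F)
    {M : ClosedSubmodule ℂ E} (hM : Reduces M H) {S : Set ℝ}
    (hS : opSpectrum (RandomSpectra.restrictTo H M hM) = Complex.ofReal '' S) :
    IsClosed S ∧ ∀ J : Set ℝ, (∀ x, h.pvm.scalarMeasure x (J ∩ S) = 0) → interior J ∩ S = ∅ := by
  have : CompleteSpace M.toSubmodule := M.isClosed.completeSpace_coe
  have hK := hH.restrictTo hM
  obtain ⟨G, hG⟩ := hK.exists_isSpectralMeasureOf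
  have hmem : ∀ s : ℝ, s ∉ S ↔ ∃ δ > 0, ∀ x, hG.pvm.scalarMeasure x (Metric.ball s δ) = 0 := by
    intro s
    rw [← hG.ofReal_notMem_opSpectrum_iff hK, hS, Complex.ofReal_injective.mem_set_image]
  have hopen : IsOpen Sᶜ := by
    rw [Metric.isOpen_iff]
    intro s hs
    obtain ⟨δ, hδ, hn⟩ := (hmem s).1 hs
    refine ⟨δ / 2, by positivity, fun t ht => (hmem t).2 ⟨δ / 2, by positivity, fun x => ?_⟩⟩
    refine measure_mono_null (Metric.ball_subset_ball' ?_) (hn x)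
    rw [Metric.mem_ball] at ht
    linarith
  refine ⟨isOpen_compl_iff.1 hopen, fun J hJ => ?_⟩
  have hcompl : ∀ x, hG.pvm.scalarMeasure x Sᶜ = 0 := fun x => by
    refine measure_null_of_locally_null _ fun s hs => ?_
    obtain ⟨δ, hδ, hn⟩ := (hmem s).1 hs
    exact ⟨Metric.ball s δ, mem_nhdsWithin_of_mem_nhds (Metric.ball_mem_nhds s hδ), hn x⟩
  -- The resolvent of the restriction is the restriction of the resolvent, so the Poisson integrals
  -- agree.
  have heq : ∀ x : M.toSubmodule, hG.pvm.scalarMeasure x = h.pvm.scalarMeasure (x : E) := by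
    intro x
    refine ext_of_poissonIntegral fun ε s hε => ?_
    have hz : ((s : ℂ) + ε * I).im ≠ 0 := by simpa using hε.ne'
    obtain ⟨R, hR⟩ := hH.exists_resolvent _ hz
    obtain ⟨R', hR', hRR'⟩ := exists_resolvent_restrictTo hH.isFormalAdjoint hM hz hR
    rw [h.poissonIntegral_scalarMeasure hH.isFormalAdjoint hε hR,
      hG.poissonIntegral_scalarMeasure hK.isFormalAdjoint hε hR', ← hRR']
    rfl
  have hJ' : ∀ x, hG.pvm.scalarMeasure x J = 0 := fun x => by
    refine measure_mono_null (t := (J ∩ S) ∪ Sᶜ) (fun t ht => ?_)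
      (measure_union_null (by rw [heq]; exact hJ x) (hcompl x))
    by_cases hts : t ∈ S
    · exact Or.inl ⟨ht, hts⟩
    · exact Or.inr hts
  rw [Set.eq_empty_iff_forall_notMem]
  rintro s ⟨hsJ, hsS⟩
  obtain ⟨δ, hδ, hsub⟩ := Metric.isOpen_iff.1 isOpen_interior s hsJ
  exact (hmem s).2 ⟨δ, hδ, fun x =>
    measure_mono_null (hsub.trans interior_subset) (hJ' x)⟩ hsS

end SpectrumAndSupport

/-! ### Random families: measurability, covariance and the abstract theorem. -/

section RandomFamilies

variable {E : Type*} [NormedAddCommGroup E] [InnerProductSpace ℂ E] [CompleteSpace E]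

theorem isSpectralMeasureOf_spectralProjection {H : E →ₗ.[ℂ] E} (hH : IsSelfAdjoint H) :
    IsSpectralMeasureOf H (spectralProjection H) := by
  have h := (isSymmetricWithResolvents_of_isSelfAdjoint hH).exists_isSpectralMeasureOf
  have e : spectralProjection H = h.choose := by
    ext1 A
    rw [spectralProjection, dif_pos h]
  rw [e]
  exact h.choose_spec

/-- The measure `A ↦ ⟪x, E_H(A) x⟫` of a self-adjoint operator `H`. -/
def selfAdjointMeasure {H : E →ₗ.[ℂ] E} (hH : IsSelfAdjoint H) (x : E) : Measure ℝ :=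
  (isSpectralMeasureOf_spectralProjection hH).pvm.scalarMeasure x

instance {H : E →ₗ.[ℂ] E} (hH : IsSelfAdjoint H) (x : E) :
    IsFiniteMeasure (selfAdjointMeasure hH x) :=
  (isSpectralMeasureOf_spectralProjection hH).pvm.isFiniteMeasure_scalarMeasure x

theorem selfAdjointMeasure_apply {H : E →ₗ.[ℂ] E} (hH : IsSelfAdjoint H) (x : E) {A : Set ℝ}
    (hA : MeasurableSet A) : selfAdjointMeasure hH x A =
      ENNReal.ofReal (inner ℂ x (spectralProjection H A x)).re := by
  have h := (isSpectralMeasureOf_spectralProjection hH).pvm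
  rw [selfAdjointMeasure, h.scalarMeasure_apply hA, h.inner_self_apply hA, Complex.ofReal_re]

theorem selfAdjointMeasure_eq_zero_iff {H : E →ₗ.[ℂ] E} (hH : IsSelfAdjoint H) (x : E) {A : Set ℝ}
    (hA : MeasurableSet A) : selfAdjointMeasure hH x A = 0 ↔ spectralProjection H A x = 0 := by
  have h := (isSpectralMeasureOf_spectralProjection hH).pvm
  rw [selfAdjointMeasure, h.scalarMeasure_apply hA]
  simp

theorem isResolventAt_resolventOp {H : E →ₗ.[ℂ] E} (hH : IsSelfAdjoint H) {z : ℂ}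
    (hz : z.im ≠ 0) : IsResolventAt H z (resolventOp H z) := by
  have h := (isSymmetricWithResolvents_of_isSelfAdjoint hH).exists_resolvent z hz
  rw [resolventOp, dif_pos h]
  exact h.choose_spec

theorem poissonIntegral_selfAdjointMeasure {H : E →ₗ.[ℂ] E} (hH : IsSelfAdjoint H) {ε s : ℝ}
    (hε : 0 < ε) {R : E →L[ℂ] E} (hR : IsResolventAt H (s + ε * I) R) (x : E) :
    poissonIntegral (selfAdjointMeasure hH x) ε s =
      ENNReal.ofReal (ε / Real.pi) * ENNReal.ofReal (‖R x‖ ^ 2) :=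
  (isSpectralMeasureOf_spectralProjection hH).poissonIntegral_scalarMeasure
    (isSymmetricWithResolvents_of_isSelfAdjoint hH).isFormalAdjoint hε hR x

theorem selfAdjointMeasure_unitaryConj {H H' : E →ₗ.[ℂ] E} (hH : IsSelfAdjoint H)
    (hH' : IsSelfAdjoint H') (U : E ≃ₗᵢ[ℂ] E) (he : H' = unitaryConj U H) (x : E) :
    selfAdjointMeasure hH' (U x) = selfAdjointMeasure hH x := by
  refine ext_of_poissonIntegral fun ε s hε => ?_
  have hz : ((s : ℂ) + ε * I).im ≠ 0 := by simpa using hε.ne'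
  have hR := isResolventAt_resolventOp hH hz
  have hR' := isResolventAt_resolventOp hH' hz
  rw [poissonIntegral_selfAdjointMeasure hH hε hR, poissonIntegral_selfAdjointMeasure hH' hε hR']
  suffices resolventOp H' (s + ε * I) (U x) = U (resolventOp H (s + ε * I) x) by
    rw [this, LinearIsometryEquiv.norm_map]
  subst he
  obtain ⟨hd, e⟩ := hR.1 x
  generalize resolventOp H (s + ε * I) x = y at hd e ⊢
  have hd' : U y ∈ (unitaryConj U H).domain := by
    change U.symm (U y) ∈ H.domain
    rwa [U.symm_apply_apply]
  refine hR'.eq_of_sub_smul ⟨U y, hd'⟩ ?_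
  have h1 : unitaryConj U H ⟨U y, hd'⟩ = U (H ⟨y, hd⟩) := by
    change U (H ⟨U.symm (U y), hd'⟩) = U (H ⟨y, hd⟩)
    congr 3
    exact U.symm_apply_apply y
  rw [h1, ← e, map_sub, map_smul]

variable {Ω : Type*} [MeasurableSpace Ω] {H : Ω → E →ₗ.[ℂ] E}

theorem IsMeasurableSelfAdjointFamily.measurable_selfAdjointMeasure
    (hH : IsMeasurableSelfAdjointFamily H) (x : E) :
    Measurable fun ω => selfAdjointMeasure (hH.isSelfAdjoint ω) x := by
  refine measurable_of_measurable_poissonIntegral ?_ fun ε s hε => ?_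
  · have : (fun ω => selfAdjointMeasure (hH.isSelfAdjoint ω) x Set.univ) =
        fun _ => ENNReal.ofReal (‖x‖ ^ 2) :=
      funext fun ω => (isSpectralMeasureOf_spectralProjection
        (hH.isSelfAdjoint ω)).pvm.scalarMeasure_univ x
    rw [this]
    exact measurable_const
  · have hz : ((s : ℂ) + ε * I).im ≠ 0 := by simpa using hε.ne'
    have hR := fun ω => isResolventAt_resolventOp (hH.isSelfAdjoint ω) hz
    -- Expresses the norm through a single matrix element of the resolvent, to which the weak
    -- measurability hypothesis applies.
    have h1 : ∀ ω, ‖resolventOp (H ω) (s + ε * I) x‖ ^ 2 =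
        (inner ℂ x (resolventOp (H ω) (s + ε * I) x)).im / ε := fun ω => by
      obtain ⟨hd, e⟩ := (hR ω).1 x
      have h2 := inner_sub_smul_self
        (isSymmetricWithResolvents_of_isSelfAdjoint (hH.isSelfAdjoint ω)).isFormalAdjoint
        ⟨_, hd⟩ (s + ε * I)
      rw [e] at h2
      simp only at h2
      rw [h2]
      simp [hε.ne']
    simp only [fun ω => poissonIntegral_selfAdjointMeasure (hH.isSelfAdjoint ω) hε (hR ω) x, h1]
    have := Complex.measurable_im.comp (hH.measurable _ hz x x)
    exact ((this.div_const ε).ennreal_ofReal).const_mul _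

theorem IsMeasurableSelfAdjointFamily.measurable_selfAdjointMeasure_apply
    (hH : IsMeasurableSelfAdjointFamily H) (x : E) {A : Set ℝ} (hA : MeasurableSet A) :
    Measurable fun ω => selfAdjointMeasure (hH.isSelfAdjoint ω) x A :=
  (Measure.measurable_coe hA).comp (hH.measurable_selfAdjointMeasure x)

theorem IsMeasurableSelfAdjointFamily.ae_spectralProjection_eq_zero
    (hH : IsMeasurableSelfAdjointFamily H) {P : Measure Ω} (x : E) {A : Set ℝ}
    (hA : MeasurableSet A)
    (h : ∫⁻ ω, ENNReal.ofReal (inner ℂ x (spectralProjection (H ω) A x)).re ∂P = 0) :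
    ∀ᵐ ω ∂P, spectralProjection (H ω) A x = 0 := by
  simp only [← fun ω => selfAdjointMeasure_apply (hH.isSelfAdjoint ω) x hA] at h
  rw [lintegral_eq_zero_iff (hH.measurable_selfAdjointMeasure_apply x hA)] at h
  filter_upwards [h] with ω hω
  exact (selfAdjointMeasure_eq_zero_iff _ x hA).1 hω

/-- By covariance the scalar measure of `H (T i ω)` at `U i x` is that of `H ω` at `x`. Thus the
claim holds at `T i ω` for almost every `ω`, and `T i` preserves `P`. -/
theorem IsErgodicOperatorFamily.ae_spectralProjection_translate_eq_zero {ι : Type*}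
    {P : Measure Ω} {T : ι → Ω → Ω} {U : ι → E ≃ₗᵢ[ℂ] E}
    (hH : IsErgodicOperatorFamily P T U H) (x : E) {A : Set ℝ} (hA : MeasurableSet A)
    (h : ∀ᵐ ω ∂P, spectralProjection (H ω) A x = 0) (i : ι) :
    ∀ᵐ ω ∂P, spectralProjection (H ω) A (U i x) = 0 := by
  have hsa := hH.isSelfAdjoint
  have hm : MeasurableSet {ω | selfAdjointMeasure (hsa ω) (U i x) A = 0} :=
    hH.measurable_selfAdjointMeasure_apply (U i x) hA (measurableSet_singleton 0)
  have h1 : ∀ᵐ ω ∂P, selfAdjointMeasure (hsa (T i ω)) (U i x) A = 0 := by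
    filter_upwards [h] with ω hω
    rw [selfAdjointMeasure_unitaryConj (hsa ω) (hsa (T i ω)) (U i) (hH.covariant i ω)]
    exact (selfAdjointMeasure_eq_zero_iff _ x hA).2 hω
  have hmp := hH.ergodicFamily.measurePreserving i
  rw [← hmp.map_eq]
  have h2 : ∀ᵐ ω ∂(Measure.map (T i) P), selfAdjointMeasure (hsa ω) (U i x) A = 0 :=
    (ae_map_iff hmp.measurable.aemeasurable hm).2 h1
  filter_upwards [h2] with ω hω
  exact (selfAdjointMeasure_eq_zero_iff _ _ hA).1 hω

theorem IsMeasurableSelfAdjointFamily.interior_inter_eq_empty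
    (hH : IsMeasurableSelfAdjointFamily H) {P : Measure Ω} [IsProbabilityMeasure P]
    {γ : Measure ℝ}
    (hγ : ∀ A, MeasurableSet A → γ A = 0 → ∀ᵐ ω ∂P, spectralProjection (H ω) A = 0)
    {S : Set ℝ} (hS : IsAlmostSureSpectrum P H S) {J : Set ℝ} (hJ : IsClosed J)
    (h0 : γ (J ∩ S) = 0) : interior J ∩ S = ∅ := by
  obtain ⟨M, hM, hspec⟩ := hS
  have key := fun ω hω =>
    (isSymmetricWithResolvents_of_isSelfAdjoint
      (hH.isSelfAdjoint ω)).isClosed_and_interior_inter_eq_empty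
      (isSpectralMeasureOf_spectralProjection (hH.isSelfAdjoint ω)) (hM ω) (S := S) hω
  -- One realization suffices to see that the nonrandom set `S` is closed. Only then is `J ∩ S`
  -- Borel, so that `hγ` applies and a second realization can be chosen with vanishing spectral
  -- projection.
  obtain ⟨ω₀, hω₀⟩ := hspec.exists
  have hA : MeasurableSet (J ∩ S) := (hJ.inter (key ω₀ hω₀).1).measurableSet
  obtain ⟨ω, hω, hω'⟩ := (hspec.and (hγ _ hA h0)).exists
  refine (key ω hω).2 J fun x => ?_
  refine (selfAdjointMeasure_eq_zero_iff (hH.isSelfAdjoint ω) x hA).2 ?_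
  rw [hω', zero_apply]

theorem IsMeasurableSelfAdjointFamily.empty_or_pos
    (hH : IsMeasurableSelfAdjointFamily H) {P : Measure Ω} [IsProbabilityMeasure P]
    (hγ : ∀ A, MeasurableSet A → volume A = 0 → ∀ᵐ ω ∂P, spectralProjection (H ω) A = 0)
    {S : Set ℝ} (hS : IsAlmostSureSpectrum P H S) : S = ∅ ∨ 0 < volume S := by
  rcases eq_or_ne (volume S) 0 with h0 | h0
  · left
    simpa using hH.interior_inter_eq_empty hγ hS isClosed_univ (by rwa [Set.univ_inter])
  · exact Or.inr (pos_iff_ne_zero.2 h0)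

/-- The projection is symmetric, so its range is orthogonal to every vector that it annihilates. -/
theorem eq_zero_of_apply_eq_zero {H : E →ₗ.[ℂ] E} (hH : IsSelfAdjoint H) {A : Set ℝ}
    (hA : MeasurableSet A) {κ : Type*} (v : κ → E) (htot : ∀ y, (∀ k, inner ℂ (v k) y = 0) → y = 0)
    (h : ∀ k, spectralProjection H A (v k) = 0) : spectralProjection H A = 0 := by
  ext1 y
  refine htot _ fun k => ?_
  rw [← (isSpectralMeasureOf_spectralProjection hH).pvm.inner_apply_left hA, h, inner_zero_left]

end RandomFamilies

/-! ### The discrete model: the translates of `δ₀` are total. -/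

section DiscreteModel

variable {d : ℕ} {Ω : Type*} [MeasurableSpace Ω] {P : Measure Ω} {T : (Fin d → ℤ) → Ω → Ω}
  {H : Ω → LatticeL2 d →ₗ.[ℂ] LatticeL2 d}

theorem latticeShift_delta₀ (i : Fin d → ℤ) : latticeShift i (delta₀ d) = lp.single 2 i 1 := by
  ext n
  rw [latticeShift_apply, delta₀, lp.coeFn_single, lp.coeFn_single]
  by_cases h : n = i
  · subst h; simp
  · rw [Pi.single_eq_of_ne h, Pi.single_eq_of_ne (sub_ne_zero.2 h)]

theorem discreteDOS_eq_zero (hH : IsErgodicOperatorFamily P T latticeShift H) {A : Set ℝ}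
    (hA : MeasurableSet A) (h : discreteDOS P H A = 0) :
    ∀ᵐ ω ∂P, spectralProjection (H ω) A = 0 := by
  have h1 := hH.ae_spectralProjection_eq_zero _ hA h
  have h2 := ae_all_iff.2 (hH.ae_spectralProjection_translate_eq_zero _ hA h1)
  filter_upwards [h2] with ω hω
  refine eq_zero_of_apply_eq_zero (hH.isSelfAdjoint ω) hA _ (fun y hy => ?_) hω
  ext i
  have := hy i
  rw [latticeShift_delta₀, lp.inner_single_left] at this
  simpa using this

end DiscreteModel

/-! ### The continuous model: the translates of the range of `χ_Λ` are total. -/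

section ContinuousModel

variable {d : ℕ} {Ω : Type*} [MeasurableSpace Ω] {P : Measure Ω} {T : (Fin d → ℤ) → Ω → Ω}
  {H : Ω → SpaceL2 d →ₗ.[ℂ] SpaceL2 d}

theorem inner_cubeIndicator_left (φ ψ : SpaceL2 d) :
    inner ℂ (cubeIndicator d φ) ψ = inner ℂ φ (cubeIndicator d ψ) := by
  rw [L2.inner_def, L2.inner_def]
  refine integral_congr_ae ?_
  filter_upwards [mulIndicator_ae (unitCube d) measurableSet_Icc φ,
    mulIndicator_ae (unitCube d) measurableSet_Icc ψ] with x h1 h2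
  rw [cubeIndicator, h1, h2]
  by_cases hx : x ∈ unitCube d <;> simp [hx]

theorem exists_sub_latticePoint_mem_unitCube (x : Fin d → ℝ) :
    ∃ i : Fin d → ℤ, x - latticePoint i ∈ unitCube d := by
  refine ⟨fun k => round (x k), fun k => ?_, fun k => ?_⟩ <;>
  · have := abs_le.1 (abs_sub_round (x k))
    simp only [Pi.sub_apply, latticePoint]
    linarith

/-- The countably many lattice translates of the unit cube cover the space, and `y` vanishes almost
everywhere on each. -/
theorem eq_zero_of_cubeIndicator_shift_eq_zero (y : SpaceL2 d)
    (h : ∀ i, cubeIndicator d ((spaceShift i).symm y) = 0) : y = 0 := by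
  have h1 : ∀ i : Fin d → ℤ, ∀ᵐ x, x - latticePoint i ∈ unitCube d → y x = 0 := by
    intro i
    set w := (spaceShift i).symm y with hw
    have h2 : ∀ᵐ x, x ∈ unitCube d → w x = 0 := by
      have h3 := mulIndicator_ae (unitCube d) measurableSet_Icc w
      have h4 : mulIndicator (unitCube d) measurableSet_Icc w = 0 := h i
      rw [h4] at h3
      filter_upwards [h3, Lp.coeFn_zero ℂ 2 (volume : Measure (Fin d → ℝ))] with x h5 h6 hx
      rw [h6, Set.indicator_of_mem hx] at h5
      exact h5.symm
    have h7 := spaceShift_ae i w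
    rw [hw, LinearIsometryEquiv.apply_symm_apply, ← hw] at h7
    filter_upwards [h7, (measurePreserving_sub_right volume
      (latticePoint i)).quasiMeasurePreserving.ae h2] with x h8 h9 hx
    rw [h8, h9 hx]
  rw [← ae_all_iff] at h1
  apply Lp.ext
  filter_upwards [h1, Lp.coeFn_zero ℂ 2 (volume : Measure (Fin d → ℝ))] with x hx h0
  obtain ⟨i, hi⟩ := exists_sub_latticePoint_mem_unitCube x
  rw [hx i hi, h0]
  rfl

theorem Orthonormal.countable_of_separable {E ι : Type*} [NormedAddCommGroup E]
    [InnerProductSpace ℂ E] [TopologicalSpace.SeparableSpace E] {v : ι → E}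
    (hv : Orthonormal ℂ v) : Countable ι := by
  have hd : ∀ i j, i ≠ j → 1 ≤ dist (v i) (v j) := by
    intro i j hij
    rw [dist_eq_norm, ← one_le_sq_iff₀ (norm_nonneg _), @norm_sub_sq ℂ, hv.1 i, hv.1 j, hv.2 hij]
    simp
  have hp : (Set.univ : Set ι).PairwiseDisjoint fun i => Metric.ball (v i) (1 / 2) := by
    intro i _ j _ hij
    refine Metric.ball_disjoint_ball ?_
    have := hd i j hij
    linarith
  exact Set.countable_univ_iff.1 (hp.countable_of_isOpen (fun _ _ => Metric.isOpen_ball)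
    fun i _ => ⟨v i, Metric.mem_ball_self (by norm_num)⟩)

theorem continuousDOS_eq_zero (hH : IsErgodicOperatorFamily P T spaceShift H) {A : Set ℝ}
    (hA : MeasurableSet A) (h : continuousDOS P H A = 0) :
    ∀ᵐ ω ∂P, spectralProjection (H ω) A = 0 := by
  set w := (exists_hilbertBasis ℂ (SpaceL2 d)).choose with hwdef
  obtain ⟨b, hb⟩ := (exists_hilbertBasis ℂ (SpaceL2 d)).choose_spec
  have : Fact ((2 : ℝ≥0∞) ≠ ∞) := ⟨ENNReal.ofNat_ne_top⟩
  -- Needed to merge the exceptional null sets of all basis vectors and lattice points into one.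
  have : Countable w := Orthonormal.countable_of_separable b.orthonormal
  have h1 : ∀ φ : w, ∀ᵐ ω ∂P, spectralProjection (H ω) A (cubeIndicator d φ) = 0 := by
    intro φ
    refine hH.ae_spectralProjection_eq_zero _ hA (le_antisymm ?_ bot_le)
    rw [← h]
    -- Each `⟨χ_Λ φ, E(A) χ_Λ φ⟩` is one nonnegative term of the trace, so its expectation is at
    -- most `ν A = 0`.
    refine lintegral_mono fun ω => ?_
    rw [inner_cubeIndicator_left]
    exact ENNReal.le_tsum (f := fun φ : w => ENNReal.ofReal (inner ℂ (φ : SpaceL2 d)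
      ((cubeIndicator d * spectralProjection (H ω) A * cubeIndicator d) φ)).re) φ
  have h2 : ∀ᵐ ω ∂P, ∀ p : w × (Fin d → ℤ),
      spectralProjection (H ω) A (spaceShift p.2 (cubeIndicator d p.1)) = 0 :=
    ae_all_iff.2 fun p => hH.ae_spectralProjection_translate_eq_zero _ hA (h1 p.1) p.2
  filter_upwards [h2] with ω hω
  refine eq_zero_of_apply_eq_zero (hH.isSelfAdjoint ω) hA _ (fun y hy => ?_) hω
  refine eq_zero_of_cubeIndicator_shift_eq_zero y fun i => ?_
  refine b.repr.injective ?_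
  rw [map_zero]
  ext φ
  have h3 := hy (φ, i)
  rw [← (spaceShift i).symm.inner_map_map, LinearIsometryEquiv.symm_apply_apply,
    inner_cubeIndicator_left] at h3
  rw [b.repr_apply_apply, hb, h3]
  rfl

end ContinuousModel

end RandomSpectra

end

theorem corollary3p2 {d : ℕ} {Ω : Type*} [MeasurableSpace Ω] (P : Measure Ω)
    [IsProbabilityMeasure P] (T : (Fin d → ℤ) → Ω → Ω) :
    -- discrete model
    (∀ H : Ω → RandomSpectra.LatticeL2 d →ₗ.[ℂ] RandomSpectra.LatticeL2 d,
      RandomSpectra.IsErgodicOperatorFamily P T RandomSpectra.latticeShift H →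
      (∀ γ : Measure ℝ, RandomSpectra.AbsCont (RandomSpectra.discreteDOS P H) γ →
        ∀ S : Set ℝ, RandomSpectra.IsAlmostSureSpectrum P H S →
        ∀ I : Set ℝ, IsClosed I → I.OrdConnected →
          γ (I ∩ S) = 0 → interior I ∩ S = ∅) ∧
      (RandomSpectra.AbsCont (RandomSpectra.discreteDOS P H) volume →
        ∀ S : Set ℝ, RandomSpectra.IsAlmostSureSpectrum P H S → S = ∅ ∨ 0 < volume S)) ∧
    -- continuous model
    (∀ H : Ω → RandomSpectra.SpaceL2 d →ₗ.[ℂ] RandomSpectra.SpaceL2 d,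
      RandomSpectra.IsErgodicOperatorFamily P T RandomSpectra.spaceShift H →
      (∀ γ : Measure ℝ, RandomSpectra.AbsCont (RandomSpectra.continuousDOS P H) γ →
        ∀ S : Set ℝ, RandomSpectra.IsAlmostSureSpectrum P H S →
        ∀ I : Set ℝ, IsClosed I → I.OrdConnected →
          γ (I ∩ S) = 0 → interior I ∩ S = ∅) ∧
      (RandomSpectra.AbsCont (RandomSpectra.continuousDOS P H) volume →
        ∀ S : Set ℝ, RandomSpectra.IsAlmostSureSpectrum P H S → S = ∅ ∨ 0 < volume S)) := by
  refine ⟨fun H hH => ⟨fun γ hγ S hS J hJ _ h0 => ?_, fun hγ S hS => ?_⟩,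
    fun H hH => ⟨fun γ hγ S hS J hJ _ h0 => ?_, fun hγ S hS => ?_⟩⟩
  · exact hH.interior_inter_eq_empty
      (fun A hA h => RandomSpectra.discreteDOS_eq_zero hH hA (hγ A hA h)) hS hJ h0
  · exact hH.empty_or_pos
      (fun A hA h => RandomSpectra.discreteDOS_eq_zero hH hA (hγ A hA h)) hS
  · exact hH.interior_inter_eq_empty
      (fun A hA h => RandomSpectra.continuousDOS_eq_zero hH hA (hγ A hA h)) hS hJ h0
  · exact hH.empty_or_pos
      (fun A hA h => RandomSpectra.continuousDOS_eq_zero hH hA (hγ A hA h)) hS
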